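/- Let $\dot W$ be a space-time white noise on $[0,\infty)\times[0,1]$ with respect to a filtration $(\mathcal F_t)_{t\ge0}$ on a probability space $(\Omega,\mathcal F,\mathbf P)$, let $\sigma>0$, let $b:\mathbf R\to[0,\infty)$ be locally Lipschitz on $\mathbf R$ and nondecreasing on $(0,\infty)$, and let $u_0:[0,1]\to[0,\infty)$ be continuous. Consider $$\partial_t u(t,x)=\partial_x^2 u(t,x)+b(u(t,x))+\sigma\dot W(t,x),\qquad x\in[0,1],\ t>0,\qquad u(0,x)=u_0(x),$$ with homogeneous Dirichlet boundary conditions. Let $p(t,x,y)=\sum_{n\ge1}2\sin(n\pi x)\sin(n\pi y)e^{-n^2\pi^2t}$ be the Dirichlet heat kernel. For each integer $N\ge1$ let $b_N(x)=b(x)$ for $|x|\le N$, $b_N(x)=b(N)$ for $x>N$, $b_N(x)=b(-N)$ for $x<-N$, and let $u_N$ be the global random field solution of the equation with $b$ replaced by $b_N$, that is, the jointly measurable and adapted process on $[0,\infty)\times[0,1]$, almost surely continuous on $(0,\infty)\times[0,1]$, such that for every $t>0$ and $x\in[0,1]$, almost surely, $$u_N(t,x)=\int_0^1p(t,x,y)u_0(y)\,dy+\int_0^t\!\int_0^1p(t-s,x,y)\,b_N(u_N(s,y))\,dy\,ds+\sigma\int_0^t\!\int_0^1p(t-s,x,y)\,W(dy\,ds).$$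 Put $\tau_N=\inf\{t>0:\sup_{x\in[0,1]}|u_N(t,x)|>N\}$ (with $\inf\emptyset=\infty$) and let $\tau_\infty=\sup_{N\ge1}\tau_N$, which is almost surely the limit of the $\tau_N$ as $N\to\infty$. (The local solution of the original equation equals $u_N$ on $[0,\tau_N)$, and $\tau_\infty$ is its blow-up time.) If the solution blows up in finite time with positive probability, i.e. if $\mathbf P(\tau_\infty<\infty)>0$, then $b$ satisfies the Osgood condition: for some $a>0$, $$\int_a^\infty\frac{ds}{b(s)}<\infty,\qquad\text{where }1/0=\infty.$$ -/

import Mathlib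

open MeasureTheory ProbabilityTheory Filter Set
open scoped NNReal ENNReal Topology

noncomputable section

namespace OsgoodSPDE

/-- Space-time `[0, ∞) × [0, 1]`. -/
abbrev SpaceTime : Type := ℝ≥0 × unitInterval

/-- Lebesgue measure on `[0, ∞) × [0, 1]`. -/
def leb : Measure SpaceTime :=
  (Measure.comap (fun t : ℝ≥0 => (t : ℝ)) volume).prod volume

/-- The heat kernel of `Δ = d²/dx²` on `[0, 1]` with Dirichlet boundary conditions, for `t > 0`:
`p(t, x, y) = ∑_{n ≥ 1} 2 sin(nπx) sin(nπy) exp(-n²π²t)`. -/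
def dirichletHeatKernel (t x y : ℝ) : ℝ :=
  ∑' n : ℕ, 2 * Real.sin ((n + 1 : ℝ) * Real.pi * x) * Real.sin ((n + 1 : ℝ) * Real.pi * y) *
    Real.exp (-((n + 1 : ℝ) ^ 2 * Real.pi ^ 2 * t))

/-- The function `(s, y) ↦ 1_{s < t} p(t - s, x, y)` on space-time. -/
def shiftedKernel (t : ℝ≥0) (x : unitInterval) : SpaceTime → ℝ :=
  Set.indicator (Set.Iio t ×ˢ Set.univ)
    (fun z => dirichletHeatKernel ((t : ℝ) - (z.1 : ℝ)) (x : ℝ) (z.2 : ℝ))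

variable {Ω : Type*} {mΩ : MeasurableSpace Ω}

/-- `W` is a space-time white noise on `[0, ∞) × [0, 1]` with respect to the filtration `ℱ`:
a centred Gaussian family indexed by the Borel sets `A` of finite measure, with
`E[W(A) W(B)] = |A ∩ B|`, such that `W(A)` is `ℱ_t`-measurable for `A ⊆ [0, t] × [0, 1]` and
the family of all `W(A)` with `A ⊆ (t, ∞) × [0, 1]` is independent of `ℱ_t`.
The values of `W` on other sets play no role. -/
structure IsWhiteNoise (P : Measure Ω) (ℱ : Filtration ℝ≥0 mΩ) (W : Set SpaceTime → Ω → ℝ) :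
    Prop where
  measurable : ∀ A, MeasurableSet A → leb A ≠ ∞ → Measurable (W A)
  gaussian : IsGaussianProcess
    (fun A : {A : Set SpaceTime // MeasurableSet A ∧ leb A ≠ ∞} => W A.1) P
  mean_zero : ∀ A, MeasurableSet A → leb A ≠ ∞ → ∫ ω, W A ω ∂P = 0
  covariance : ∀ A B, MeasurableSet A → leb A ≠ ∞ → MeasurableSet B → leb B ≠ ∞ →
    ∫ ω, W A ω * W B ω ∂P = (leb (A ∩ B)).toReal
  adapted : ∀ (t : ℝ≥0) (A : Set SpaceTime), MeasurableSet A → leb A ≠ ∞ →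
    A ⊆ Set.Iic t ×ˢ Set.univ → Measurable[ℱ t] (W A)
  indep : ∀ t : ℝ≥0, Indep
    (⨆ A : {A : Set SpaceTime // MeasurableSet A ∧ leb A ≠ ∞ ∧ A ⊆ Set.Ioi t ×ˢ Set.univ},
      MeasurableSpace.comap (W A.1) inferInstance) (ℱ t) P

/-- The integral of a simple function `∑ c 1_{f = c}` against `W`. -/
def simpleWienerIntegral (W : Set SpaceTime → Ω → ℝ) (f : SimpleFunc SpaceTime ℝ) (ω : Ω) : ℝ :=
  ∑ c ∈ f.range, c * W (f ⁻¹' {c}) ω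

/-- `X` is (a version of) the Wiener integral `∫ h dW` of `h ∈ L²([0, ∞) × [0, 1])`: the
`L²(P)`-limit of the integrals of square integrable simple functions converging to `h` in `L²`. -/
def HasWienerIntegral (P : Measure Ω) (W : Set SpaceTime → Ω → ℝ) (h : SpaceTime → ℝ)
    (X : Ω → ℝ) : Prop :=
  MemLp h 2 leb ∧ MemLp X 2 P ∧
    ∃ f : ℕ → SimpleFunc SpaceTime ℝ,
      (∀ n, MemLp (f n) 2 leb) ∧
      Tendsto (fun n => eLpNorm (fun z => f n z - h z) 2 leb) atTop (𝓝 0) ∧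
      Tendsto (fun n => eLpNorm (fun ω => simpleWienerIntegral W (f n) ω - X ω) 2 P)
        atTop (𝓝 0)

/-- `u` is a global random field (mild) solution, with almost surely continuous paths on
`(0, ∞) × [0, 1]`, of `∂ₜu = Δu + g(u) + σẆ` on `[0, 1]` with homogeneous Dirichlet boundary
conditions and initial condition `u₀`. (Continuity is not required at time `0`, since `u₀` need
not vanish at the boundary points.) -/
structure IsGlobalSolution (P : Measure Ω) (ℱ : Filtration ℝ≥0 mΩ) (W : Set SpaceTime → Ω → ℝ)
    (g : ℝ → ℝ) (σ : ℝ) (u₀ : unitInterval → ℝ) (u : ℝ≥0 → unitInterval → Ω → ℝ) : Prop where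
  jointlyMeasurable : Measurable (fun q : (ℝ≥0 × unitInterval) × Ω => u q.1.1 q.1.2 q.2)
  adapted : ∀ t x, Measurable[ℱ t] (u t x)
  mild : ∀ (t : ℝ≥0) (x : unitInterval), 0 < t → ∃ X : Ω → ℝ,
    HasWienerIntegral P W (shiftedKernel t x) X ∧
    ∀ᵐ ω ∂P,
      Integrable (fun z : SpaceTime => shiftedKernel t x z * g (u z.1 z.2 ω)) leb ∧
      u t x ω = (∫ y : unitInterval, dirichletHeatKernel t x y * u₀ y)
        + (∫ z : SpaceTime, shiftedKernel t x z * g (u z.1 z.2 ω) ∂leb)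
        + σ * X ω
  continuous : ∀ᵐ ω ∂P,
    ContinuousOn (fun z : SpaceTime => u z.1 z.2 ω) (Set.Ioi 0 ×ˢ Set.univ)

/-- The truncation `b_N` of `b`: it is `b(x)` for `|x| ≤ N`, `b(N)` for `x > N` and `b(-N)` for
`x < -N`. -/
def truncateDrift (b : ℝ → ℝ) (N : ℕ) (x : ℝ) : ℝ :=
  if |x| ≤ N then b x else if (N : ℝ) < x then b N else b (-N)

/-- `τ_N = inf {t > 0 : sup_{x ∈ [0, 1]} |v(t, x)| > N}`, with `inf ∅ = ∞`. -/
def exitTime (v : ℝ≥0 → unitInterval → Ω → ℝ) (N : ℕ) (ω : Ω) : ℝ≥0∞ :=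
  ⨅ (t : ℝ≥0) (_ : 0 < t ∧ (N : ℝ≥0∞) < ⨆ x : unitInterval, ‖v t x ω‖ₑ), (t : ℝ≥0∞)

/-- The blow-up time `τ_∞`, the monotone limit of the exit times `τ_N`, `N ≥ 1`, where `u N` is
the solution of the equation with drift `b_N`. -/
def blowupTime (u : ℕ → ℝ≥0 → unitInterval → Ω → ℝ) (ω : Ω) : ℝ≥0∞ :=
  ⨆ (N : ℕ) (_ : 1 ≤ N), exitTime (u N) N ω

/-- The Osgood condition: `∫_a^∞ ds / b(s) < ∞` for some `a > 0`, where `1/0 = ∞`. -/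
def OsgoodCondition (b : ℝ → ℝ) : Prop :=
  ∃ a : ℝ, 0 < a ∧ ∫⁻ s in Set.Ioi a, (ENNReal.ofReal (b s))⁻¹ < ∞

end OsgoodSPDE

end

/-! The contrapositive is proved: if the Osgood integral diverges, then for every `T` almost surely
`τ_∞ ≥ T`. Fix a path on which the initial term plus the noise term stays in `[-A, A]` on `(0, T)`.
The heat kernel and the drift are nonnegative, so `u_N ≥ -A`. On `[-A, ∞)` the truncated drifts are
dominated by one positive monotone function `B = const + b(max · 0)` that does not depend on `N`.
The kernel has mass at most one, so `φ(t) = sup_x u_N(t, x)` satisfies `φ(t) ≤ A + ∫₀ᵗ B(φ)`.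
Divergence of `∫ 1/B` yields `K`, independent of `N`, with `∫_A^K 1/B > T`; then `φ ≤ K` on `(0,
T)`, and `τ_N ≥ T` once `N ≥ max K A` (`osgood_comparison`, `path_mem_Icc`, `ae_le_blowupTime`).

Two inputs need work. Positivity of the kernel is invisible in its sine series. The kernel is half
the difference of a theta function at `π(x - y)` and `π(x + y)`, and by the Jacobi triple product
that function is a nonnegative increasing function of the cosine of its argument
(`thetaCos_le_of_cos_le`).

Boundedness of the noise term near time `0` is extracted from the assumed continuity of `u_1` at
positive times. On `[1, T + 1]` the path is bounded, hence so is the noise term at countably many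
points. Reversing the sign of the noise after time `1` preserves all covariances, so the noise term
built from the noise after time `1` is bounded too; by time translation it has the law of the noise
term on `(0, T)` (`IsWhiteNoise.ae_bounded_of_ae_bounded_shift`). -/

noncomputable section

namespace OsgoodSPDE

/-! ### The Jacobi triple product and the theta function. -/

section

/-- The `q`-Pochhammer symbol `(q; q)_n`. -/
def qPochhammer (q : ℝ) (n : ℕ) : ℝ := ∏ j ∈ Finset.range n, (1 - q ^ (j + 1))

/-- The reciprocal of `(q; q)_n`, extended by zero to negative `n`. -/
def qPochhammerInv (q : ℝ) (n : ℤ) : ℝ := if n < 0 then 0 else (qPochhammer q n.toNat)⁻¹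

lemma qPochhammer_succ (q : ℝ) (n : ℕ) :
    qPochhammer q (n + 1) = qPochhammer q n * (1 - q ^ (n + 1)) := by
  simp [qPochhammer, Finset.prod_range_succ]

lemma qPochhammer_pos {q : ℝ} (h0 : 0 < q) (h1 : q < 1) (n : ℕ) : 0 < qPochhammer q n :=
  Finset.prod_pos fun j _ => sub_pos.2 (pow_lt_one₀ h0.le h1 (by omega))

lemma qPochhammer_antitone {q : ℝ} (h0 : 0 < q) (h1 : q < 1) : Antitone (qPochhammer q) := by
  refine antitone_nat_of_succ_le fun n => ?_
  rw [qPochhammer_succ]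
  have := qPochhammer_pos h0 h1 n
  have : 0 < q ^ (n + 1) := by positivity
  nlinarith

lemma qPochhammerInv_natCast (q : ℝ) (n : ℕ) : qPochhammerInv q n = (qPochhammer q n)⁻¹ := by
  simp [qPochhammerInv]

lemma qPochhammerInv_of_neg (q : ℝ) {n : ℤ} (hn : n < 0) : qPochhammerInv q n = 0 := by
  simp [qPochhammerInv, hn]

lemma qPochhammerInv_nonneg {q : ℝ} (h0 : 0 < q) (h1 : q < 1) (n : ℤ) :
    0 ≤ qPochhammerInv q n := by
  unfold qPochhammerInv
  split_ifs
  · exact le_rfl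
  · exact (inv_pos.2 (qPochhammer_pos h0 h1 _)).le

/-- Extension by zero makes the recursion valid at every integer: at `n = 0` the factor `1 - q ^ n`
vanishes. -/
lemma qPochhammerInv_sub_one {q : ℝ} (h0 : 0 < q) (h1 : q < 1) (n : ℤ) :
    qPochhammerInv q (n - 1) = (1 - q ^ n) * qPochhammerInv q n := by
  rcases lt_trichotomy n 0 with hn | rfl | hn
  · rw [qPochhammerInv_of_neg q hn, qPochhammerInv_of_neg q (by omega), mul_zero]
  · simp [qPochhammerInv]
  · obtain ⟨k, rfl⟩ : ∃ k : ℕ, n = ((k + 1 : ℕ) : ℤ) := ⟨n.toNat - 1, by omega⟩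
    have h : ((k + 1 : ℕ) : ℤ) - 1 = (k : ℤ) := by push_cast; ring
    rw [h, qPochhammerInv_natCast, qPochhammerInv_natCast, qPochhammer_succ, zpow_natCast]
    have := (qPochhammer_pos h0 h1 k).ne'
    have : 1 - q ^ (k + 1) ≠ 0 := (sub_pos.2 (pow_lt_one₀ h0.le h1 (by omega))).ne'
    field_simp

/-- The Laurent coefficients of the finite Jacobi triple product. -/
def jacobiCoeff (q : ℝ) (m : ℕ) (k : ℤ) : ℝ :=
  q ^ (k * k) * (qPochhammer (q ^ 2) (2 * m) * qPochhammerInv (q ^ 2) (m + k) *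
    qPochhammerInv (q ^ 2) (m - k))

/-- This is the effect on Laurent coefficients of multiplying by `(1 + q^(2m+1) z)(1 + q^(2m+1)
z⁻¹)`. Every reciprocal symbol is reduced to index `m + 1 + k` or `m + 1 - k`, which leaves a
rational identity in `q`, `q ^ m`, `q ^ k` and needs no boundary cases. -/
lemma jacobiCoeff_succ {q : ℝ} (h0 : 0 < q) (h1 : q < 1) (m : ℕ) (k : ℤ) :
    jacobiCoeff q (m + 1) k = (1 + q ^ (4 * m + 2)) * jacobiCoeff q m k +
      q ^ (2 * m + 1) * (jacobiCoeff q m (k - 1) + jacobiCoeff q m (k + 1)) := by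
  have hQ0 : 0 < q ^ 2 := by positivity
  have hQ1 : q ^ 2 < 1 := pow_lt_one₀ h0.le h1 (by norm_num)
  have hq := h0.ne'
  have e1 := qPochhammerInv_sub_one hQ0 hQ1 (m + 1 + k)
  have e2 := qPochhammerInv_sub_one hQ0 hQ1 (m + 1 - k)
  have e3 := qPochhammerInv_sub_one hQ0 hQ1 (m + k)
  have e4 := qPochhammerInv_sub_one hQ0 hQ1 (m - k)
  rw [show (m + 1 + k - 1 : ℤ) = m + k by ring] at e1
  rw [show (m + 1 - k - 1 : ℤ) = m - k by ring] at e2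
  unfold jacobiCoeff
  rw [show (m + (k - 1) : ℤ) = m + k - 1 by ring, show (m - (k - 1) : ℤ) = m + 1 - k by ring,
    show (m + (k + 1) : ℤ) = m + 1 + k by ring, show (m - (k + 1) : ℤ) = m - k - 1 by ring,
    e3, e4, e1, e2, show 2 * (m + 1) = 2 * m + 1 + 1 by ring, qPochhammer_succ, qPochhammer_succ]
  push_cast
  have z1 : (q ^ 2) ^ ((m : ℤ) + 1 + k) = q ^ 2 * (q ^ m) ^ 2 * (q ^ k) ^ 2 := by
    rw [zpow_add₀ hQ0.ne', zpow_add₀ hQ0.ne', zpow_natCast, zpow_one, ← pow_mul, mul_comm 2 m,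
      pow_mul, ← zpow_natCast (q ^ k), ← zpow_natCast q 2, ← zpow_mul, ← zpow_mul, mul_comm k]
    ring
  have z2 : (q ^ 2) ^ ((m : ℤ) + 1 - k) = q ^ 2 * (q ^ m) ^ 2 / (q ^ k) ^ 2 := by
    rw [zpow_sub₀ hQ0.ne', zpow_add₀ hQ0.ne', zpow_natCast, zpow_one, ← pow_mul, mul_comm 2 m,
      pow_mul, ← zpow_natCast (q ^ k), ← zpow_natCast q 2, ← zpow_mul, ← zpow_mul, mul_comm k]
    ring
  have z3 : (q ^ 2) ^ ((m : ℤ) + k) = (q ^ m) ^ 2 * (q ^ k) ^ 2 := by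
    rw [zpow_add₀ hQ0.ne', zpow_natCast, ← pow_mul, mul_comm 2 m,
      pow_mul, ← zpow_natCast (q ^ k), ← zpow_natCast q 2, ← zpow_mul, ← zpow_mul, mul_comm k]
  have z4 : (q ^ 2) ^ ((m : ℤ) - k) = (q ^ m) ^ 2 / (q ^ k) ^ 2 := by
    rw [zpow_sub₀ hQ0.ne', zpow_natCast, ← pow_mul, mul_comm 2 m,
      pow_mul, ← zpow_natCast (q ^ k), ← zpow_natCast q 2, ← zpow_mul, ← zpow_mul, mul_comm k]
  have z5 : q ^ ((k - 1) * (k - 1)) = q ^ (k * k) * q / (q ^ k) ^ 2 := by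
    rw [show (k - 1) * (k - 1) = k * k + 1 - k * 2 by ring, zpow_sub₀ hq, zpow_add₀ hq, zpow_one,
      zpow_mul _ k 2]
    norm_cast
  have z6 : q ^ ((k + 1) * (k + 1)) = q ^ (k * k) * q * (q ^ k) ^ 2 := by
    rw [show (k + 1) * (k + 1) = k * k + 1 + k * 2 by ring, zpow_add₀ hq, zpow_add₀ hq, zpow_one,
      zpow_mul _ k 2]
    norm_cast
  rw [z1, z2, z3, z4, z5, z6]
  have y1 : (q ^ 2) ^ (2 * m + 1) = q ^ 2 * (q ^ m) ^ 4 := by ring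
  have y2 : (q ^ 2) ^ (2 * m + 1 + 1) = q ^ 4 * (q ^ m) ^ 4 := by ring
  have y3 : q ^ (4 * m + 2) = q ^ 2 * (q ^ m) ^ 4 := by ring
  have y4 : q ^ (2 * m + 1) = q * (q ^ m) ^ 2 := by ring
  rw [y1, y2, y3, y4]
  have hB : q ^ k ≠ 0 := zpow_ne_zero k hq
  generalize q ^ k = B at *
  generalize q ^ (k * k) = K
  generalize q ^ m = A
  generalize qPochhammerInv (q ^ 2) (↑m + 1 + k) = R
  generalize qPochhammerInv (q ^ 2) (↑m + 1 - k) = S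
  generalize qPochhammer (q ^ 2) (2 * m) = T
  field_simp
  ring

lemma jacobiCoeff_eq_zero (q : ℝ) (m : ℕ) {k : ℤ} (hk : k ∉ Finset.Icc (-m : ℤ) m) :
    jacobiCoeff q m k = 0 := by
  rw [Finset.mem_Icc, not_and_or] at hk
  unfold jacobiCoeff
  rcases hk with hk | hk
  · rw [qPochhammerInv_of_neg _ (show (m + k : ℤ) < 0 by omega)]; ring
  · rw [qPochhammerInv_of_neg _ (show (m - k : ℤ) < 0 by omega)]; ring

/-- The finite Jacobi triple product. -/
lemma hasSum_jacobiCoeff {q : ℝ} (h0 : 0 < q) (h1 : q < 1) {z : ℂ} (hz : z ≠ 0) (m : ℕ) :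
    HasSum (fun k : ℤ => (jacobiCoeff q m k : ℂ) * z ^ k)
      (∏ j ∈ Finset.range m, (1 + (q : ℂ) ^ (4 * j + 2) + q ^ (2 * j + 1) * (z + z⁻¹))) := by
  induction m with
  | zero =>
    have : (fun k : ℤ => (jacobiCoeff q 0 k : ℂ) * z ^ k) = fun k => if k = 0 then 1 else 0 := by
      funext k
      split_ifs with hk
      · subst hk; simp [jacobiCoeff, qPochhammerInv, qPochhammer]
      · rw [jacobiCoeff_eq_zero q 0 (by simpa using hk)]; simp
    rw [this]
    simpa using hasSum_ite_eq (0 : ℤ) (1 : ℂ)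
  | succ m ih =>
    rw [Finset.prod_range_succ]
    set S := ∏ j ∈ Finset.range m, (1 + (q : ℂ) ^ (4 * j + 2) + q ^ (2 * j + 1) * (z + z⁻¹))
    have s1 : HasSum (fun k : ℤ => (jacobiCoeff q m (k - 1) : ℂ) * z ^ k) (S * z) := by
      convert! ((Equiv.subRight (1 : ℤ)).hasSum_iff.2 ih).mul_right z using 2 with k
      simp only [Function.comp, Equiv.subRight_apply]
      rw [mul_assoc, ← zpow_add_one₀ hz, sub_add_cancel]
    have s2 : HasSum (fun k : ℤ => (jacobiCoeff q m (k + 1) : ℂ) * z ^ k) (S * z⁻¹) := by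
      convert! ((Equiv.addRight (1 : ℤ)).hasSum_iff.2 ih).mul_right z⁻¹ using 2 with k
      simp only [Function.comp, Equiv.coe_addRight]
      rw [mul_assoc, ← zpow_sub_one₀ hz, add_sub_cancel_right]
    convert! (ih.mul_left (1 + (q : ℂ) ^ (4 * m + 2))).add
      ((s1.add s2).mul_left ((q : ℂ) ^ (2 * m + 1))) using 1
    · funext k; rw [jacobiCoeff_succ h0 h1]; push_cast; ring
    · ring

lemma hasSum_jacobiCoeff_cos {q : ℝ} (h0 : 0 < q) (h1 : q < 1) (w : ℝ) (m : ℕ) :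
    HasSum (fun k : ℤ => jacobiCoeff q m k * Real.cos (k * w))
      (∏ j ∈ Finset.range m, (1 + q ^ (4 * j + 2) + q ^ (2 * j + 1) * (2 * Real.cos w))) := by
  have h := hasSum_jacobiCoeff h0 h1 (Complex.exp_ne_zero (w * Complex.I)) m
  have hre := Complex.hasSum_re h
  convert! hre using 1
  · funext k
    rw [← Complex.exp_int_mul, ← mul_assoc, Complex.re_ofReal_mul]
    congr 1
    have : ((k : ℂ) * w) = ((k * w : ℝ) : ℂ) := by push_cast; rfl
    rw [this, Complex.exp_ofReal_mul_I_re]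
  · rw [← Complex.ofReal_re (∏ j ∈ Finset.range m, _)]
    congr 1
    push_cast
    refine Finset.prod_congr rfl fun j _ => ?_
    rw [Complex.two_cos, ← Complex.exp_neg, neg_mul]

/-- The theta function `∑_{k ∈ ℤ} q^{k²} cos (k w)`. -/
def thetaCos (q w : ℝ) : ℝ := ∑' k : ℤ, q ^ (k * k) * Real.cos (k * w)

lemma zpow_mul_self_le {q : ℝ} (h0 : 0 < q) (h1 : q < 1) (k : ℤ) :
    q ^ (k * k) ≤ q ^ k.natAbs := by
  rw [← Int.natAbs_mul_self' k]
  norm_cast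
  exact pow_le_pow_of_le_one h0.le h1.le (Nat.le_mul_self _)

lemma summable_zpow_mul_self {q : ℝ} (h0 : 0 < q) (h1 : q < 1) :
    Summable (fun k : ℤ => q ^ (k * k)) := by
  refine Summable.of_nonneg_of_le (fun k => (zpow_pos h0 _).le) (zpow_mul_self_le h0 h1) ?_
  have := summable_geometric_of_lt_one h0.le h1
  refine summable_int_iff_summable_nat_and_neg.2 ⟨by simpa using this, by simpa using this⟩

lemma one_sub_le_qPochhammer_div {q : ℝ} (h0 : 0 < q) (h1 : q < 1) (n l : ℕ) :
    1 - q ^ n / (1 - q) ≤ qPochhammer q (n + l) / qPochhammer q n := by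
  have hq : 0 < 1 - q := sub_pos.2 h1
  -- The ratio is `∏ (1 - q ^ j)` over `n < j ≤ n + l`, at least one minus the sum of the `q ^ j`.
  -- The added geometric tail pays for the next factor in the induction.
  have key : 1 - q ^ n / (1 - q) + q ^ (n + l + 1) / (1 - q) ≤
      qPochhammer q (n + l) / qPochhammer q n := by
    induction l with
    | zero =>
      rw [add_zero, div_self (qPochhammer_pos h0 h1 n).ne']
      have : q ^ (n + 1) / (1 - q) ≤ q ^ n / (1 - q) := by
        gcongr ?_ / _
        exact pow_le_pow_of_le_one h0.le h1.le (by omega)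
      linarith
    | succ l ih =>
      rw [← add_assoc, qPochhammer_succ, mul_div_right_comm]
      have h2 : qPochhammer q (n + l) / qPochhammer q n ≤ 1 :=
        div_le_one_of_le₀ (qPochhammer_antitone h0 h1 (by omega)) (qPochhammer_pos h0 h1 n).le
      have h3 : 0 < q ^ (n + l + 1) := by positivity
      have h4 : q ^ (n + l + 1) / (1 - q) = q ^ (n + l + 1) + q ^ (n + l + 1 + 1) / (1 - q) := by
        field_simp
        ring
      nlinarith
  have : 0 ≤ q ^ (n + l + 1) / (1 - q) := by positivity
  linarith

lemma tendsto_qPochhammer_mul_inv {q : ℝ} (h0 : 0 < q) (h1 : q < 1) (k : ℤ) :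
    Tendsto (fun m : ℕ => qPochhammer q (2 * m) * qPochhammerInv q (m + k)) atTop (𝓝 1) := by
  have hlim : Tendsto (fun m : ℕ => 1 - q ^ (m + k).toNat / (1 - q)) atTop (𝓝 1) := by
    have h : Tendsto (fun m : ℕ => ((m : ℤ) + k).toNat) atTop atTop := by
      refine tendsto_atTop_atTop.2 fun c => ⟨c + k.natAbs, fun m hm => by omega⟩
    simpa using (((tendsto_pow_atTop_nhds_zero_of_lt_one h0.le h1).comp h).div_const (1 - q)).const_sub 1
  refine tendsto_of_tendsto_of_tendsto_of_le_of_le' hlim tendsto_const_nhds ?_ ?_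
  all_goals
    filter_upwards [eventually_ge_atTop k.natAbs] with m hm
    obtain ⟨n, hn⟩ : ∃ n : ℕ, (m : ℤ) + k = n := ⟨(m + k).toNat, by omega⟩
    obtain ⟨l, hl⟩ : ∃ l : ℕ, 2 * m = n + l := ⟨2 * m - n, by omega⟩
    rw [hn, hl, qPochhammerInv_natCast, ← div_eq_mul_inv]
  · exact one_sub_le_qPochhammer_div h0 h1 n l
  · exact div_le_one_of_le₀ (qPochhammer_antitone h0 h1 (by omega)) (qPochhammer_pos h0 h1 n).le

lemma qPochhammer_mul_inv_le_one {q : ℝ} (h0 : 0 < q) (h1 : q < 1) {m : ℕ} {n : ℤ}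
    (hn : n ≤ 2 * m) : qPochhammer q (2 * m) * qPochhammerInv q n ≤ 1 := by
  by_cases h : n < 0
  · rw [qPochhammerInv_of_neg q h]; simp
  · obtain ⟨n, rfl⟩ := Int.eq_ofNat_of_zero_le (not_lt.1 h)
    rw [qPochhammerInv_natCast, ← div_eq_mul_inv]
    exact div_le_one_of_le₀ (qPochhammer_antitone h0 h1 (by omega)) (qPochhammer_pos h0 h1 n).le

/-- After multiplication by `(q²; q²)_{2m}`, the `k`-th coefficient is `q ^ (k * k)` times two
ratios that lie in `[0, 1]` and tend to `1`, so dominated convergence over `k` applies. Only the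
positivity of the prefactor matters later, not its limit. -/
lemma tendsto_jacobi_prod {q : ℝ} (h0 : 0 < q) (h1 : q < 1) (w : ℝ) :
    Tendsto (fun m : ℕ => qPochhammer (q ^ 2) (2 * m) *
      ∏ j ∈ Finset.range m, (1 + q ^ (4 * j + 2) + q ^ (2 * j + 1) * (2 * Real.cos w)))
      atTop (𝓝 (thetaCos q w)) := by
  have hQ0 : 0 < q ^ 2 := by positivity
  have hQ1 : q ^ 2 < 1 := pow_lt_one₀ h0.le h1 (by norm_num)
  have h (m : ℕ) := ((hasSum_jacobiCoeff_cos h0 h1 w m).mul_left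
    (qPochhammer (q ^ 2) (2 * m))).tsum_eq
  simp_rw [← h]
  refine tendsto_tsum_of_dominated_convergence (summable_zpow_mul_self h0 h1) (fun k => ?_)
    (Eventually.of_forall fun m k => ?_)
  · have := ((tendsto_qPochhammer_mul_inv hQ0 hQ1 k).mul
      (tendsto_qPochhammer_mul_inv hQ0 hQ1 (-k))).mul_const (q ^ (k * k) * Real.cos (k * w))
    rw [one_mul, one_mul] at this
    refine this.congr fun m => ?_
    rw [jacobiCoeff, ← sub_eq_add_neg]
    ring
  · have e : qPochhammer (q ^ 2) (2 * m) * (jacobiCoeff q m k * Real.cos (k * w)) =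
        (qPochhammer (q ^ 2) (2 * m) * qPochhammerInv (q ^ 2) (m + k)) *
        (qPochhammer (q ^ 2) (2 * m) * qPochhammerInv (q ^ 2) (m - k)) *
        (q ^ (k * k) * Real.cos (k * w)) := by
      rw [jacobiCoeff]; ring
    have hP := (qPochhammer_pos hQ0 hQ1 (2 * m)).le
    by_cases hk : k ∈ Finset.Icc (-m : ℤ) m
    · rw [Finset.mem_Icc] at hk
      have a1 := qPochhammer_mul_inv_le_one hQ0 hQ1 (m := m) (n := m + k) (by omega)
      have a2 := qPochhammer_mul_inv_le_one hQ0 hQ1 (m := m) (n := m - k) (by omega)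
      have b1 := mul_nonneg hP (qPochhammerInv_nonneg hQ0 hQ1 (m + k))
      have b2 := mul_nonneg hP (qPochhammerInv_nonneg hQ0 hQ1 (m - k))
      have hz := (zpow_pos h0 (k * k)).le
      rw [e, norm_mul, norm_mul, Real.norm_of_nonneg b1, Real.norm_of_nonneg b2, norm_mul,
        Real.norm_of_nonneg hz]
      calc _ ≤ 1 * 1 * (q ^ (k * k) * 1) := by
            gcongr
            exact Real.abs_cos_le_one _
        _ = _ := by ring
    · rw [jacobiCoeff_eq_zero q m hk]
      simpa using (zpow_pos h0 (k * k)).le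

lemma jacobi_factor_nonneg (r w : ℝ) (h0 : 0 ≤ r) :
    0 ≤ 1 + r ^ 2 + r * (2 * Real.cos w) := by
  nlinarith [sq_nonneg (1 - r), Real.neg_one_le_cos w]

lemma thetaCos_nonneg {q : ℝ} (h0 : 0 < q) (h1 : q < 1) (w : ℝ) : 0 ≤ thetaCos q w := by
  have hQ0 : 0 < q ^ 2 := by positivity
  have hQ1 : q ^ 2 < 1 := pow_lt_one₀ h0.le h1 (by norm_num)
  refine ge_of_tendsto' (tendsto_jacobi_prod h0 h1 w) fun m =>
    mul_nonneg (qPochhammer_pos hQ0 hQ1 _).le (Finset.prod_nonneg fun j _ => ?_)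
  rw [show q ^ (4 * j + 2) = (q ^ (2 * j + 1)) ^ 2 by ring]
  exact jacobi_factor_nonneg _ _ (by positivity)

/-- Each factor of the finite product is nonnegative and increasing in `cos w`; the inequality
passes to the limit. -/
lemma thetaCos_le_of_cos_le {q : ℝ} (h0 : 0 < q) (h1 : q < 1) {v w : ℝ}
    (h : Real.cos w ≤ Real.cos v) : thetaCos q w ≤ thetaCos q v := by
  have hQ0 : 0 < q ^ 2 := by positivity
  have hQ1 : q ^ 2 < 1 := pow_lt_one₀ h0.le h1 (by norm_num)
  refine le_of_tendsto_of_tendsto' (tendsto_jacobi_prod h0 h1 w) (tendsto_jacobi_prod h0 h1 v)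
    fun m => mul_le_mul_of_nonneg_left (Finset.prod_le_prod (fun j _ => ?_) fun j _ => ?_)
      (qPochhammer_pos hQ0 hQ1 _).le
  · rw [show q ^ (4 * j + 2) = (q ^ (2 * j + 1)) ^ 2 by ring]
    exact jacobi_factor_nonneg _ _ (by positivity)
  · gcongr

lemma summable_pow_succ_sq {q : ℝ} (h0 : 0 < q) (h1 : q < 1) :
    Summable (fun n : ℕ => q ^ ((n + 1) ^ 2)) := by
  refine Summable.of_nonneg_of_le (fun k => by positivity) (fun n => ?_)
    (summable_geometric_of_lt_one h0.le h1)
  exact pow_le_pow_of_le_one h0.le h1.le (by nlinarith)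

lemma summable_pow_succ_sq_mul_cos {q : ℝ} (h0 : 0 < q) (h1 : q < 1) (w : ℝ) :
    Summable (fun n : ℕ => q ^ ((n + 1) ^ 2) * Real.cos ((n + 1 : ℝ) * w)) := by
  refine Summable.of_norm_bounded (summable_pow_succ_sq h0 h1) fun n => ?_
  rw [norm_mul, Real.norm_of_nonneg (by positivity)]
  exact mul_le_of_le_one_right (by positivity) (Real.abs_cos_le_one _)

lemma thetaCos_eq {q : ℝ} (h0 : 0 < q) (h1 : q < 1) (w : ℝ) :
    thetaCos q w = 1 + 2 * ∑' n : ℕ, q ^ ((n + 1) ^ 2) * Real.cos ((n + 1 : ℝ) * w) := by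
  have e1 (n : ℕ) : q ^ (((n : ℤ) + 1) * ((n : ℤ) + 1)) * Real.cos (((n : ℤ) + 1 : ℤ) * w) =
      q ^ ((n + 1) ^ 2) * Real.cos ((n + 1 : ℝ) * w) := by
    rw [show ((n : ℤ) + 1) * (n + 1) = (((n + 1) ^ 2 : ℕ) : ℤ) by push_cast; ring, zpow_natCast]
    push_cast; rfl
  have e2 (n : ℕ) : q ^ (-((n : ℤ) + 1) * -((n : ℤ) + 1)) *
      Real.cos ((-((n : ℤ) + 1) : ℤ) * w) =
      q ^ ((n + 1) ^ 2) * Real.cos ((n + 1 : ℝ) * w) := by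
    rw [neg_mul_neg, ← e1]
    push_cast
    rw [neg_mul, Real.cos_neg]
  have hs := summable_pow_succ_sq_mul_cos h0 h1 w
  rw [thetaCos, tsum_of_add_one_of_neg_add_one]
  · simp_rw [e1, e2]; simp; ring
  · simp_rw [e1]; exact hs
  · simp_rw [e2]; exact hs

/-! ### Positivity and mass of the Dirichlet heat kernel. -/

lemma exp_eq_pow (t : ℝ) (n : ℕ) :
    Real.exp (-((n + 1 : ℝ) ^ 2 * Real.pi ^ 2 * t)) =
      Real.exp (-(Real.pi ^ 2 * t)) ^ ((n + 1) ^ 2) := by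
  rw [← Real.exp_nat_mul]; push_cast; ring_nf

lemma exp_neg_pi_sq_lt_one {t : ℝ} (ht : 0 < t) : Real.exp (-(Real.pi ^ 2 * t)) < 1 := by
  rw [Real.exp_lt_one_iff]
  have := Real.pi_pos
  have : 0 < Real.pi ^ 2 * t := by positivity
  linarith

/-- Method of images: `2 sin a sin b = cos (a - b) - cos (a + b)` termwise, with `q = exp(-π²t)`. -/
lemma dirichletHeatKernel_eq {t : ℝ} (ht : 0 < t) (x y : ℝ) :
    dirichletHeatKernel t x y =
      (thetaCos (Real.exp (-(Real.pi ^ 2 * t))) (Real.pi * (x - y)) -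
        thetaCos (Real.exp (-(Real.pi ^ 2 * t))) (Real.pi * (x + y))) / 2 := by
  have h0 := Real.exp_pos (-(Real.pi ^ 2 * t))
  have h1 := exp_neg_pi_sq_lt_one ht
  rw [thetaCos_eq h0 h1, thetaCos_eq h0 h1, dirichletHeatKernel]
  have := (summable_pow_succ_sq_mul_cos h0 h1 (Real.pi * (x - y))).tsum_sub
    (summable_pow_succ_sq_mul_cos h0 h1 (Real.pi * (x + y)))
  rw [show ∀ a b : ℝ, (1 + 2 * a - (1 + 2 * b)) / 2 = a - b by intros; ring, ← this]
  refine tsum_congr fun n => ?_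
  rw [exp_eq_pow, show ((n + 1 : ℝ) * (Real.pi * (x - y))) =
    (n + 1 : ℝ) * Real.pi * x - (n + 1 : ℝ) * Real.pi * y by ring,
    show ((n + 1 : ℝ) * (Real.pi * (x + y))) =
    (n + 1 : ℝ) * Real.pi * x + (n + 1 : ℝ) * Real.pi * y by ring, Real.cos_sub, Real.cos_add]
  ring

lemma dirichletHeatKernel_nonneg {t x y : ℝ} (ht : 0 < t) (hx : x ∈ Icc (0 : ℝ) 1)
    (hy : y ∈ Icc (0 : ℝ) 1) : 0 ≤ dirichletHeatKernel t x y := by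
  rw [dirichletHeatKernel_eq ht]
  have h : Real.cos (Real.pi * (x + y)) ≤ Real.cos (Real.pi * (x - y)) := by
    rw [mul_sub, mul_add, Real.cos_sub, Real.cos_add]
    have s (z : ℝ) (hz : z ∈ Icc (0 : ℝ) 1) : 0 ≤ Real.sin (Real.pi * z) :=
      Real.sin_nonneg_of_nonneg_of_le_pi (mul_nonneg Real.pi_pos.le hz.1)
        (mul_le_of_le_one_right Real.pi_pos.le hz.2)
    nlinarith [mul_nonneg (s x hx) (s y hy)]
  have := thetaCos_le_of_cos_le (Real.exp_pos _) (exp_neg_pi_sq_lt_one ht) h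
  linarith

lemma continuous_thetaCos {q : ℝ} (h0 : 0 < q) (h1 : q < 1) : Continuous (thetaCos q) := by
  refine continuous_tsum (fun k => by fun_prop) (summable_zpow_mul_self h0 h1) fun k w => ?_
  rw [norm_mul, Real.norm_of_nonneg (zpow_pos h0 _).le]
  exact mul_le_of_le_one_right (zpow_pos h0 _).le (Real.abs_cos_le_one _)

lemma continuous_dirichletHeatKernel {t : ℝ} (ht : 0 < t) (x : ℝ) :
    Continuous (dirichletHeatKernel t x) := by
  have := continuous_thetaCos (Real.exp_pos _) (exp_neg_pi_sq_lt_one ht)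
  rw [show dirichletHeatKernel t x = _ from funext (dirichletHeatKernel_eq ht x)]
  fun_prop

lemma integral_thetaCos {q : ℝ} (h0 : 0 < q) (h1 : q < 1) :
    ∫ w in (-Real.pi)..Real.pi, thetaCos q w = 2 * Real.pi := by
  have hs := intervalIntegral.hasSum_intervalIntegral_of_summable_norm (a := -Real.pi) (b := Real.pi)
    (f := fun k : ℤ => (⟨fun w => q ^ (k * k) * Real.cos (k * w), by fun_prop⟩ : C(ℝ, ℝ))) ?_
  · have e : ∀ k : ℤ, ∫ w in (-Real.pi)..Real.pi, q ^ (k * k) * Real.cos (k * w) =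
        if k = 0 then 2 * Real.pi else 0 := by
      intro k
      rw [intervalIntegral.integral_const_mul]
      split_ifs with hk
      · subst hk; simp; ring
      · rw [intervalIntegral.integral_comp_mul_left _ (by exact_mod_cast hk : (k : ℝ) ≠ 0)]
        simp [Real.sin_int_mul_pi]
    have := hs.tsum_eq
    simp only [ContinuousMap.coe_mk, e, tsum_ite_eq] at this
    exact this.symm
  · refine Summable.of_nonneg_of_le (fun _ => norm_nonneg _) (fun k => ?_)
      (summable_zpow_mul_self h0 h1)
    refine (ContinuousMap.norm_le _ (zpow_pos h0 _).le).2 fun w => ?_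
    rw [ContinuousMap.restrict_apply, ContinuousMap.coe_mk, norm_mul,
      Real.norm_of_nonneg (zpow_pos h0 _).le]
    exact mul_le_of_le_one_right (zpow_pos h0 _).le (Real.abs_cos_le_one _)

lemma thetaCos_periodic (q : ℝ) : Function.Periodic (thetaCos q) (2 * Real.pi) := by
  intro w
  refine tsum_congr fun k => ?_
  rw [mul_add, Real.cos_add_int_mul_two_pi]

/-- Dropping the nonnegative image term leaves a theta integral over half a period. Nonnegativity
lets it grow to a full period, where only the term `k = 0` contributes. -/
lemma integral_dirichletHeatKernel_le_one {t x : ℝ} (ht : 0 < t) :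
    ∫ y : unitInterval, dirichletHeatKernel t x y ≤ 1 := by
  set q := Real.exp (-(Real.pi ^ 2 * t))
  have h0 : 0 < q := Real.exp_pos _
  have h1 : q < 1 := exp_neg_pi_sq_lt_one ht
  have hc := continuous_thetaCos h0 h1
  have hcp := continuous_dirichletHeatKernel ht x
  rw [show ∫ y : unitInterval, dirichletHeatKernel t x y = ∫ y in Icc (0:ℝ) 1, dirichletHeatKernel t x y from
    integral_subtype measurableSet_Icc _, integral_Icc_eq_integral_Ioc,
    ← intervalIntegral.integral_of_le zero_le_one]
  calc ∫ y in (0:ℝ)..1, dirichletHeatKernel t x y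
      ≤ ∫ y in (0:ℝ)..1, thetaCos q (Real.pi * x - Real.pi * y) / 2 := by
        refine intervalIntegral.integral_mono_on zero_le_one (hcp.intervalIntegrable _ _)
          (Continuous.intervalIntegrable (by fun_prop) _ _) fun y _ => ?_
        rw [dirichletHeatKernel_eq ht, mul_sub]
        linarith [thetaCos_nonneg h0 h1 (Real.pi * (x + y))]
    _ = (Real.pi)⁻¹ * (∫ w in (Real.pi * x - Real.pi)..(Real.pi * x), thetaCos q w) / 2 := by
        rw [intervalIntegral.integral_div, intervalIntegral.integral_comp_sub_mul (thetaCos q) Real.pi_ne_zero]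
        simp
    _ ≤ (Real.pi)⁻¹ * (∫ w in (Real.pi * x - Real.pi)..(Real.pi * x + Real.pi), thetaCos q w) / 2 := by
        have := Real.pi_pos
        gcongr
        refine intervalIntegral.integral_mono_interval le_rfl (by linarith) (by linarith)
          (Eventually.of_forall fun w => thetaCos_nonneg h0 h1 w) (hc.intervalIntegrable _ _)
    _ = 1 := by
        have := (thetaCos_periodic q).intervalIntegral_add_eq (Real.pi * x - Real.pi) (-Real.pi)
        rw [show Real.pi * x - Real.pi + 2 * Real.pi = Real.pi * x + Real.pi by ring,
          show -Real.pi + 2 * Real.pi = Real.pi by ring, integral_thetaCos h0 h1] at this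
        rw [this]
        have := Real.pi_ne_zero
        field_simp

end

/-! ### Wiener integrals: isometry, existence, and laws determined by covariances. -/

section

section L2

variable {α : Type*} {m : MeasurableSpace α} {μ : Measure α}

lemma norm_toLp_sq_eq_integral {f : α → ℝ} (hf : MemLp f 2 μ) :
    ‖hf.toLp f‖ ^ 2 = ∫ a, f a ^ 2 ∂μ := by
  rw [← real_inner_self_eq_norm_sq, L2.inner_def]
  refine integral_congr_ae ?_
  filter_upwards [hf.coeFn_toLp] with a ha
  rw [ha, real_inner_self_eq_norm_sq, Real.norm_eq_abs, sq_abs]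

lemma tendsto_integral_sq {ι : Type*} {l : Filter ι} {f : ι → α → ℝ} {g : α → ℝ}
    (hf : ∀ n, MemLp (f n) 2 μ) (hg : MemLp g 2 μ)
    (h : Tendsto (fun n => eLpNorm (fun a => f n a - g a) 2 μ) l (𝓝 0)) :
    Tendsto (fun n => ∫ a, f n a ^ 2 ∂μ) l (𝓝 (∫ a, g a ^ 2 ∂μ)) := by
  have := (Lp.tendsto_Lp_iff_tendsto_eLpNorm'' f hf g hg).2 h
  simpa only [norm_toLp_sq_eq_integral] using (this.norm.pow 2)

lemma tendsto_eLpNorm_sum_mul_sub {ι : Type*} (s : Finset ι) (c : ι → ℝ) {f : ℕ → ι → α → ℝ}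
    {g : ι → α → ℝ} (hf : ∀ n i, AEStronglyMeasurable (f n i) μ)
    (hg : ∀ i, AEStronglyMeasurable (g i) μ)
    (h : ∀ i, Tendsto (fun n => eLpNorm (fun a => f n i a - g i a) 2 μ) atTop (𝓝 0)) :
    Tendsto (fun n => eLpNorm (fun a => ∑ i ∈ s, c i * f n i a - ∑ i ∈ s, c i * g i a) 2 μ)
      atTop (𝓝 0) := by
  have hb (n : ℕ) : eLpNorm (fun a => ∑ i ∈ s, c i * f n i a - ∑ i ∈ s, c i * g i a) 2 μ ≤
      ∑ i ∈ s, ‖c i‖ₑ * eLpNorm (fun a => f n i a - g i a) 2 μ := by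
    have e : (fun a => ∑ i ∈ s, c i * f n i a - ∑ i ∈ s, c i * g i a) =
        ∑ i ∈ s, c i • fun a => f n i a - g i a := by
      funext a
      rw [← Finset.sum_sub_distrib, Finset.sum_apply]
      refine Finset.sum_congr rfl fun i _ => ?_
      simp [mul_sub]
    rw [e]
    refine (eLpNorm_sum_le (fun i _ => ((hf n i).sub (hg i)).const_smul _) (by norm_num)).trans ?_
    exact Finset.sum_le_sum fun i _ => (eLpNorm_const_smul_le)
  refine tendsto_of_tendsto_of_tendsto_of_le_of_le tendsto_const_nhds ?_ (fun _ => zero_le) hb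
  rw [show (0 : ℝ≥0∞) = ∑ i ∈ s, ‖c i‖ₑ * 0 by simp]
  exact tendsto_finsetSum _ fun i _ => ENNReal.Tendsto.const_mul (h i) (Or.inr enorm_ne_top)

lemma simpleFunc_eq_sum (f : SimpleFunc α ℝ) (a : α) :
    f a = ∑ c ∈ f.range, c * (f ⁻¹' {c}).indicator (fun _ => (1 : ℝ)) a := by
  rw [Finset.sum_eq_single (f a)]
  · simp
  · intro c _ hc
    rw [Set.indicator_of_notMem (by simpa using hc.symm), mul_zero]
  · intro h; exact absurd (f.mem_range_self a) h

lemma memLp_sum_mul {ι : Type*} (s : Finset ι) (c : ι → ℝ) {g : ι → α → ℝ}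
    (hg : ∀ i, MemLp (g i) 2 μ) : MemLp (fun a => ∑ i ∈ s, c i * g i a) 2 μ :=
  memLp_finsetSum s fun i _ => (hg i).const_mul (c i)

lemma integral_sum_mul_sum {ι κ : Type*} (s : Finset ι) (t : Finset κ) {F : ι → α → ℝ}
    {G : κ → α → ℝ} (hF : ∀ i, MemLp (F i) 2 μ) (hG : ∀ j, MemLp (G j) 2 μ) :
    ∫ a, (∑ i ∈ s, F i a) * (∑ j ∈ t, G j a) ∂μ =
      ∑ i ∈ s, ∑ j ∈ t, ∫ a, F i a * G j a ∂μ := by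
  have h (i : ι) (j : κ) : Integrable (fun a => F i a * G j a) μ := (hF i).integrable_mul (hG j)
  simp_rw [Finset.sum_mul_sum]
  rw [integral_finsetSum _ fun i _ => integrable_finsetSum _ fun j _ => h i j]
  exact Finset.sum_congr rfl fun i _ => integral_finsetSum _ fun j _ => h i j

end L2

variable {Ω : Type*} {mΩ : MeasurableSpace Ω} {P : Measure Ω} {ℱ : Filtration ℝ≥0 mΩ}
  {W : Set SpaceTime → Ω → ℝ}

/-- Finite linear combinations of the values of `W` on sets of finite measure. -/
def noiseSpan (W : Set SpaceTime → Ω → ℝ) : Submodule ℝ (Ω → ℝ) :=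
  Submodule.span ℝ (Set.range fun A : {A : Set SpaceTime // MeasurableSet A ∧ leb A ≠ ∞} => W A.1)

namespace IsWhiteNoise

lemma hasGaussianLaw_of_mem_noiseSpan (hW : IsWhiteNoise P ℱ W) {Y : Ω → ℝ}
    (hY : Y ∈ noiseSpan W) : HasGaussianLaw Y P := by
  obtain ⟨c, rfl⟩ := Finsupp.mem_span_range_iff_exists_finsupp.1 hY
  exact (hW.gaussian.smul c).hasGaussianLaw_sum

lemma memLp (hW : IsWhiteNoise P ℱ W) {A : Set SpaceTime} (hA : MeasurableSet A)
    (hA' : leb A ≠ ∞) : MemLp (W A) 2 P :=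
  (hW.gaussian.hasGaussianLaw_eval ⟨A, hA, hA'⟩).memLp_two

lemma integral_eq_zero_of_mem_noiseSpan (hW : IsWhiteNoise P ℱ W) {Y : Ω → ℝ}
    (hY : Y ∈ noiseSpan W) : ∫ ω, Y ω ∂P = 0 := by
  have := hW.gaussian.isProbabilityMeasure
  obtain ⟨c, rfl⟩ := Finsupp.mem_span_range_iff_exists_finsupp.1 hY
  simp only [Finsupp.sum, Finset.sum_apply, Pi.smul_apply, smul_eq_mul]
  rw [integral_finsetSum _ fun A _ =>
    ((hW.memLp A.2.1 A.2.2).integrable (by norm_num)).const_mul _]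
  refine Finset.sum_eq_zero fun A _ => ?_
  rw [integral_const_mul, hW.mean_zero _ A.2.1 A.2.2, mul_zero]

lemma integral_cexp_of_mem_noiseSpan (hW : IsWhiteNoise P ℱ W) {Y : Ω → ℝ}
    (hY : Y ∈ noiseSpan W) :
    ∫ ω, Complex.exp (Y ω * Complex.I) ∂P = Complex.exp (-(∫ ω, Y ω ^ 2 ∂P : ℝ) / 2) := by
  have := hW.gaussian.isProbabilityMeasure
  have hG := hW.hasGaussianLaw_of_mem_noiseSpan hY
  have h0 := hW.integral_eq_zero_of_mem_noiseSpan hY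
  have h := hG.charFun_map_eq 1
  have hm := hG.aemeasurable
  rw [charFun_apply_real, integral_map hm (by fun_prop)] at h
  simp only [Complex.ofReal_one, one_mul, RCLike.inner_apply, map_one, mul_one, h0,
    Complex.ofReal_zero, zero_mul, zero_sub] at h
  rw [variance_of_integral_eq_zero hm h0] at h
  rw [h, neg_div]

/-- Gaussianity survives `L²` limits: along an almost surely convergent subsequence the left side
converges by domination, the right side because second moments converge. -/
lemma integral_cexp_of_tendsto (hW : IsWhiteNoise P ℱ W) {Y : ℕ → Ω → ℝ} {Z : Ω → ℝ}
    (hY : ∀ n, Y n ∈ noiseSpan W) (hZ : MemLp Z 2 P)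
    (h : Tendsto (fun n => eLpNorm (fun ω => Y n ω - Z ω) 2 P) atTop (𝓝 0)) :
    ∫ ω, Complex.exp (Z ω * Complex.I) ∂P = Complex.exp (-(∫ ω, Z ω ^ 2 ∂P : ℝ) / 2) := by
  have := hW.gaussian.isProbabilityMeasure
  have hYm n := (hW.hasGaussianLaw_of_mem_noiseSpan (hY n)).memLp_two
  obtain ⟨ns, hns, hlim⟩ := (tendstoInMeasure_of_tendsto_eLpNorm two_ne_zero
    (fun n => (hYm n).1) hZ.1 h).exists_seq_tendsto_ae
  have l1 : Tendsto (fun n => ∫ ω, Complex.exp (Y (ns n) ω * Complex.I) ∂P) atTop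
      (𝓝 (∫ ω, Complex.exp (Z ω * Complex.I) ∂P)) := by
    refine tendsto_integral_of_dominated_convergence (fun _ => 1) (fun n => ?_)
      (integrable_const _) (fun n => ?_) ?_
    · have := (hYm (ns n)).1.aemeasurable
      exact AEMeasurable.aestronglyMeasurable (by fun_prop)
    · exact Eventually.of_forall fun ω => by rw [Complex.norm_exp_ofReal_mul_I]
    · filter_upwards [hlim] with ω hω
      exact ((by fun_prop : Continuous fun x : ℝ => Complex.exp (x * Complex.I)).tendsto _).comp hω
  have l2 : Tendsto (fun n => Complex.exp (-(∫ ω, Y (ns n) ω ^ 2 ∂P : ℝ) / 2)) atTop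
      (𝓝 (Complex.exp (-(∫ ω, Z ω ^ 2 ∂P : ℝ) / 2))) :=
    ((by fun_prop : Continuous fun x : ℝ => Complex.exp (-(x : ℂ) / 2)).tendsto _).comp
      ((tendsto_integral_sq hYm hZ h).comp hns.tendsto_atTop)
  refine tendsto_nhds_unique l1 (l2.congr fun n => ?_)
  rw [hW.integral_cexp_of_mem_noiseSpan (hY _)]

end IsWhiteNoise

lemma simpleWienerIntegral_mem_noiseSpan {f : SimpleFunc SpaceTime ℝ} (hf : MemLp f 2 leb) :
    simpleWienerIntegral W f ∈ noiseSpan W := by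
  have : simpleWienerIntegral W f = ∑ c ∈ f.range, c • W (f ⁻¹' {c}) := by
    funext ω; simp [simpleWienerIntegral, Finset.sum_apply]
  rw [this]
  refine Submodule.sum_mem _ fun c _ => ?_
  -- The fibre over `0` may have infinite measure, where `W` is unconstrained; its coefficient
  -- removes it.
  rcases eq_or_ne c 0 with rfl | hc
  · simp
  · exact Submodule.smul_mem _ _ (Submodule.subset_span ⟨⟨_, f.measurableSet_fiber c,
      (SimpleFunc.measure_preimage_lt_top_of_memLp two_ne_zero ENNReal.ofNat_ne_top f hf c hc).ne⟩, rfl⟩)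

namespace IsWhiteNoise

lemma memLp_simpleWienerIntegral (hW : IsWhiteNoise P ℱ W) {f : SimpleFunc SpaceTime ℝ}
    (hf : MemLp f 2 leb) : MemLp (simpleWienerIntegral W f) 2 P :=
  (hW.hasGaussianLaw_of_mem_noiseSpan (simpleWienerIntegral_mem_noiseSpan hf)).memLp_two

lemma integral_simpleWienerIntegral_mul (hW : IsWhiteNoise P ℱ W) {f g : SimpleFunc SpaceTime ℝ}
    (hf : MemLp f 2 leb) (hg : MemLp g 2 leb) :
    ∫ ω, simpleWienerIntegral W f ω * simpleWienerIntegral W g ω ∂P = ∫ z, f z * g z ∂leb := by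
  have fin {k : SimpleFunc SpaceTime ℝ} (hk : MemLp k 2 leb) {c : ℝ} (hc : c ≠ 0) :
      leb (k ⁻¹' {c}) ≠ ∞ :=
    (SimpleFunc.measure_preimage_lt_top_of_memLp two_ne_zero ENNReal.ofNat_ne_top k hk c hc).ne
  have m1 {k : SimpleFunc SpaceTime ℝ} (hk : MemLp k 2 leb) (c : ℝ) :
      MemLp (fun ω => c * W (k ⁻¹' {c}) ω) 2 P := by
    rcases eq_or_ne c 0 with rfl | hc
    · simp
    · exact (hW.memLp (k.measurableSet_fiber c) (fin hk hc)).const_mul c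
  have m2 {k : SimpleFunc SpaceTime ℝ} (hk : MemLp k 2 leb) (c : ℝ) :
      MemLp (fun z => c * (k ⁻¹' {c}).indicator (fun _ => (1 : ℝ)) z) 2 leb := by
    rcases eq_or_ne c 0 with rfl | hc
    · simp
    · exact (memLp_indicator_const 2 (k.measurableSet_fiber c) 1 (Or.inr (fin hk hc))).const_mul c
  have e2 : ∫ z, f z * g z ∂leb =
      ∫ z, (∑ c ∈ f.range, c * (f ⁻¹' {c}).indicator (fun _ => (1 : ℝ)) z) *
        (∑ d ∈ g.range, d * (g ⁻¹' {d}).indicator (fun _ => (1 : ℝ)) z) ∂leb := by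
    simp_rw [← simpleFunc_eq_sum]
  rw [e2, integral_sum_mul_sum _ _ (m2 hf) (m2 hg)]
  refine (integral_sum_mul_sum _ _ (m1 hf) (m1 hg)).trans ?_
  refine Finset.sum_congr rfl fun c _ => Finset.sum_congr rfl fun d _ => ?_
  rcases eq_or_ne c 0 with rfl | hc
  · simp
  rcases eq_or_ne d 0 with rfl | hd
  · simp
  simp_rw [mul_mul_mul_comm c _ d _]
  rw [integral_const_mul, integral_const_mul, hW.covariance _ _ (f.measurableSet_fiber c)
    (fin hf hc) (g.measurableSet_fiber d) (fin hg hd)]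
  congr 1
  simp_rw [← Set.inter_indicator_mul]
  simp only [mul_one]
  rw [integral_indicator_const _ ((f.measurableSet_fiber c).inter (g.measurableSet_fiber d))]
  simp [Measure.real]

lemma integral_sq_sum_simpleWienerIntegral (hW : IsWhiteNoise P ℱ W) {ι : Type*} (s : Finset ι)
    (c : ι → ℝ) {f : ι → SimpleFunc SpaceTime ℝ} (hf : ∀ i, MemLp (f i) 2 leb) :
    ∫ ω, (∑ i ∈ s, c i * simpleWienerIntegral W (f i) ω) ^ 2 ∂P =
      ∫ z, (∑ i ∈ s, c i * f i z) ^ 2 ∂leb := by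
  simp_rw [sq]
  rw [integral_sum_mul_sum _ _ (fun i => (hf i).const_mul (c i)) fun i => (hf i).const_mul (c i),
    integral_sum_mul_sum _ _ (fun i => (hW.memLp_simpleWienerIntegral (hf i)).const_mul (c i))
      fun i => (hW.memLp_simpleWienerIntegral (hf i)).const_mul (c i)]
  refine Finset.sum_congr rfl fun i _ => Finset.sum_congr rfl fun j _ => ?_
  simp_rw [mul_mul_mul_comm (c i) _ (c j) _]
  rw [integral_const_mul, integral_const_mul, hW.integral_simpleWienerIntegral_mul (hf i) (hf j)]

/-- The isometry is proved directly for combinations, approximating each integrand separately.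
Linearity and uniqueness of the Wiener integral then follow from it. -/
lemma integral_sq_sum (hW : IsWhiteNoise P ℱ W) {ι : Type*} (s : Finset ι) (c : ι → ℝ)
    {h : ι → SpaceTime → ℝ} {X : ι → Ω → ℝ} (hX : ∀ i, HasWienerIntegral P W (h i) (X i)) :
    ∫ ω, (∑ i ∈ s, c i * X i ω) ^ 2 ∂P = ∫ z, (∑ i ∈ s, c i * h i z) ^ 2 ∂leb := by
  choose hh hXm f hf hfh hfX using hX
  have l1 := tendsto_integral_sq
    (fun n => memLp_sum_mul s c fun i => hW.memLp_simpleWienerIntegral (hf i n))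
    (memLp_sum_mul s c hXm) (tendsto_eLpNorm_sum_mul_sub s c
      (fun n i => (hW.memLp_simpleWienerIntegral (hf i n)).1) (fun i => (hXm i).1) hfX)
  have l2 := tendsto_integral_sq (fun n => memLp_sum_mul s c fun i => hf i n)
    (memLp_sum_mul s c hh) (tendsto_eLpNorm_sum_mul_sub s c
      (fun n i => (hf i n).1) (fun i => (hh i).1) hfh)
  refine tendsto_nhds_unique l1 (l2.congr fun n => ?_)
  rw [hW.integral_sq_sum_simpleWienerIntegral s c fun i => hf i n]

lemma integral_cexp_sum (hW : IsWhiteNoise P ℱ W) {ι : Type*} (s : Finset ι) (c : ι → ℝ)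
    {h : ι → SpaceTime → ℝ} {X : ι → Ω → ℝ} (hX : ∀ i, HasWienerIntegral P W (h i) (X i)) :
    ∫ ω, Complex.exp ((∑ i ∈ s, c i * X i ω : ℝ) * Complex.I) ∂P =
      Complex.exp (-(∫ z, (∑ i ∈ s, c i * h i z) ^ 2 ∂leb : ℝ) / 2) := by
  rw [← hW.integral_sq_sum s c hX]
  choose hh hXm f hf hfh hfX using hX
  refine hW.integral_cexp_of_tendsto
    (Y := fun n ω => ∑ i ∈ s, c i * simpleWienerIntegral W (f i n) ω) (fun n => ?_)
    (memLp_sum_mul s c hXm) (tendsto_eLpNorm_sum_mul_sub s c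
      (fun n i => (hW.memLp_simpleWienerIntegral (hf i n)).1) (fun i => (hXm i).1) hfX)
  have : (fun ω => ∑ i ∈ s, c i * simpleWienerIntegral W (f i n) ω) =
      ∑ i ∈ s, c i • simpleWienerIntegral W (f i n) := by
    funext ω; simp [Finset.sum_apply]
  rw [this]
  exact Submodule.sum_mem _ fun i _ =>
    Submodule.smul_mem _ _ (simpleWienerIntegral_mem_noiseSpan (hf i n))

/-- A linear relation between integrands gives the same relation between Wiener integrals. -/
lemma sum_ae_eq_zero (hW : IsWhiteNoise P ℱ W) {ι : Type*} (s : Finset ι) (c : ι → ℝ)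
    {h : ι → SpaceTime → ℝ} {X : ι → Ω → ℝ} (hX : ∀ i, HasWienerIntegral P W (h i) (X i))
    (h0 : ∀ z, ∑ i ∈ s, c i * h i z = 0) : ∀ᵐ ω ∂P, ∑ i ∈ s, c i * X i ω = 0 := by
  have h1 := hW.integral_sq_sum s c hX
  simp only [h0, ne_eq, OfNat.ofNat_ne_zero, not_false_eq_true, zero_pow, integral_zero] at h1
  have hm := memLp_sum_mul s c fun i => (hX i).2.1
  filter_upwards [(integral_eq_zero_iff_of_nonneg (fun ω => sq_nonneg _) hm.integrable_sq).1 h1]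
    with ω hω
  simpa using hω

lemma wienerIntegral_unique (hW : IsWhiteNoise P ℱ W) {h : SpaceTime → ℝ} {X Y : Ω → ℝ}
    (hX : HasWienerIntegral P W h X) (hY : HasWienerIntegral P W h Y) : X =ᵐ[P] Y := by
  have := hW.sum_ae_eq_zero (ι := Fin 2) Finset.univ ![1, -1] (h := fun _ => h) (X := ![X, Y])
    (fun i => by fin_cases i <;> simpa) (fun z => by simp)
  filter_upwards [this] with ω hω
  simp at hω
  linarith

/-- The isometry turns `L²` approximation of the integrand into a Cauchy sequence of simple
integrals, and `L²(P)` is complete. -/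
lemma exists_wienerIntegral (hW : IsWhiteNoise P ℱ W) {h : SpaceTime → ℝ} (hh : MemLp h 2 leb) :
    ∃ X : Ω → ℝ, HasWienerIntegral P W h X := by
  have hex (n : ℕ) := hh.exists_simpleFunc_eLpNorm_sub_lt ENNReal.ofNat_ne_top
    (ε := ((n : ℝ≥0∞) + 1)⁻¹) (by simp)
  choose f hfh hf using hex
  have hlim : Tendsto (fun n => eLpNorm (fun z => f n z - h z) 2 leb) atTop (𝓝 0) := by
    have h0 : Tendsto (fun n : ℕ => ((n : ℝ≥0∞) + 1)⁻¹) atTop (𝓝 0) := by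
      have := (tendsto_add_atTop_iff_nat 1).2 ENNReal.tendsto_inv_nat_nhds_zero
      simpa using this
    refine tendsto_of_tendsto_of_tendsto_of_le_of_le tendsto_const_nhds h0 (fun _ => zero_le)
      fun n => ?_
    have : (fun z => f n z - h z) = (f n : SpaceTime → ℝ) - h := rfl
    simp only [this]
    rw [eLpNorm_sub_comm]
    exact (hfh n).le
  have hI n := hW.memLp_simpleWienerIntegral (hf n)
  have hiso (n k : ℕ) : dist ((hI n).toLp _) ((hI k).toLp _) =
      dist ((hf n).toLp _) ((hf k).toLp _) := by
    rw [dist_eq_norm, dist_eq_norm, ← MemLp.toLp_sub, ← MemLp.toLp_sub,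
      ← sq_eq_sq₀ (norm_nonneg _) (norm_nonneg _), norm_toLp_sq_eq_integral,
      norm_toLp_sq_eq_integral]
    have := hW.integral_sq_sum_simpleWienerIntegral (ι := Fin 2) Finset.univ ![1, -1]
      (f := ![f n, f k]) (fun i => by fin_cases i <;> simp [hf])
    simpa [← sub_eq_add_neg] using this
  have hc : CauchySeq fun n => (hI n).toLp _ := by
    have h1 := ((Lp.tendsto_Lp_iff_tendsto_eLpNorm'' (fun n => (f n : SpaceTime → ℝ)) hf h hh).2
      hlim).cauchySeq
    rw [Metric.cauchySeq_iff] at h1 ⊢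
    simpa only [hiso] using h1
  obtain ⟨X, hX⟩ := cauchySeq_tendsto_of_complete hc
  refine ⟨X, hh, Lp.memLp X, f, hf, hlim, ?_⟩
  have := (Lp.tendsto_Lp_iff_tendsto_eLpNorm'' (fun n => simpleWienerIntegral W (f n)) hI X
    (Lp.memLp X)).1 (by rwa [Lp.toLp_coeFn])
  exact this

end IsWhiteNoise

/-- Two countable families of Wiener integrals with the same covariance have the same law. -/
lemma IsWhiteNoise.map_eq_map (hW : IsWhiteNoise P ℱ W) {ι : Type*} [Countable ι]
    {h h' : ι → SpaceTime → ℝ} {X X' : ι → Ω → ℝ}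
    (hX : ∀ i, HasWienerIntegral P W (h i) (X i))
    (hX' : ∀ i, HasWienerIntegral P W (h' i) (X' i))
    (hcov : ∀ (s : Finset ι) (c : ι → ℝ),
      ∫ z, (∑ i ∈ s, c i * h i z) ^ 2 ∂leb = ∫ z, (∑ i ∈ s, c i * h' i z) ^ 2 ∂leb) :
    P.map (fun ω i => X i ω) = P.map (fun ω i => X' i ω) := by
  classical
  have := hW.gaussian.isProbabilityMeasure
  have mX : AEMeasurable (fun ω i => X i ω) P :=
    aemeasurable_pi_iff.2 fun i => (hX i).2.1.1.aemeasurable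
  have mX' : AEMeasurable (fun ω i => X' i ω) P :=
    aemeasurable_pi_iff.2 fun i => (hX' i).2.1.1.aemeasurable
  have := Measure.isProbabilityMeasure_map mX
  have := Measure.isProbabilityMeasure_map mX'
  -- A law on the product space is determined by its finite-dimensional marginals, and these by
  -- their characteristic functions.
  refine IsProjectiveLimit.unique (P := fun I => (P.map fun ω i => X i ω).map I.restrict)
    (fun I => rfl) fun I => ?_
  have mr : Measurable (I.restrict : (ι → ℝ) → I → ℝ) := Finset.measurable_restrict I
  have := Measure.isProbabilityMeasure_map (μ := P.map fun ω i => X i ω) mr.aemeasurable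
  have := Measure.isProbabilityMeasure_map (μ := P.map fun ω i => X' i ω) mr.aemeasurable
  refine Measure.ext_of_charFunDual (funext fun L => ?_)
  have key {Y : ι → Ω → ℝ} (mY : AEMeasurable (fun ω i => Y i ω) P) :
      charFunDual ((P.map fun ω i => Y i ω).map I.restrict) L =
        ∫ ω, Complex.exp ((∑ i : I, L (Pi.single i 1) * Y i ω : ℝ) * Complex.I) ∂P := by
    rw [charFunDual_apply, integral_map mr.aemeasurable (by fun_prop),
      integral_map mY (by fun_prop)]
    refine integral_congr_ae (Eventually.of_forall fun ω => ?_)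
    have : L (I.restrict fun i => Y i ω) = ∑ i : I, L (Pi.single i 1) * Y i ω := by
      conv_lhs => rw [← Finset.univ_sum_single (I.restrict fun i => Y i ω), map_sum]
      refine Finset.sum_congr rfl fun i _ => ?_
      rw [show Pi.single i (I.restrict (fun i => Y i ω) i) =
        (Y i ω) • (Pi.single i (1 : ℝ) : I → ℝ) by rw [← Pi.single_smul]; simp, map_smul,
        smul_eq_mul, mul_comm]
    simp only [this]
  set c : ι → ℝ := fun i => if hi : i ∈ I then L (Pi.single ⟨i, hi⟩ 1) else 0 with hc
  have hsum (g : ι → ℝ) : ∑ i : I, L (Pi.single i 1) * g i = ∑ i ∈ I, c i * g i := by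
    rw [← Finset.sum_coe_sort I]
    refine Finset.sum_congr rfl fun i _ => ?_
    simp [hc]
  rw [key mX, key mX']
  have hs (Y : ι → Ω → ℝ) (ω : Ω) := hsum fun i => Y i ω
  simp_rw [hs]
  rw [hW.integral_cexp_sum I c hX, hW.integral_cexp_sum I c hX', hcov]

/-- Almost sure boundedness of a countable family of Wiener integrals depends only on the
covariance. -/
lemma IsWhiteNoise.ae_bounded_of_cov_eq (hW : IsWhiteNoise P ℱ W) {ι : Type*} [Countable ι]
    {h h' : ι → SpaceTime → ℝ} {X X' : ι → Ω → ℝ}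
    (hX : ∀ i, HasWienerIntegral P W (h i) (X i))
    (hX' : ∀ i, HasWienerIntegral P W (h' i) (X' i))
    (hcov : ∀ (s : Finset ι) (c : ι → ℝ),
      ∫ z, (∑ i ∈ s, c i * h i z) ^ 2 ∂leb = ∫ z, (∑ i ∈ s, c i * h' i z) ^ 2 ∂leb)
    (hb : ∀ᵐ ω ∂P, ∃ K : ℕ, ∀ i, |X i ω| ≤ K) : ∀ᵐ ω ∂P, ∃ K : ℕ, ∀ i, |X' i ω| ≤ K := by
  have mX : AEMeasurable (fun ω i => X i ω) P :=
    aemeasurable_pi_iff.2 fun i => (hX i).2.1.1.aemeasurable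
  have mX' : AEMeasurable (fun ω i => X' i ω) P :=
    aemeasurable_pi_iff.2 fun i => (hX' i).2.1.1.aemeasurable
  -- Boundedness is a measurable event in the product space because both `ι` and the range of `K`
  -- are countable.
  have ms : MeasurableSet {v : ι → ℝ | ∃ K : ℕ, ∀ i, |v i| ≤ K} := by
    simp only [Set.ofPred_exists, Set.ofPred_forall]
    exact MeasurableSet.iUnion fun K => MeasurableSet.iInter fun i =>
      measurableSet_le (by fun_prop) measurable_const
  have := (ae_map_iff mX ms).2 hb
  rw [hW.map_eq_map hX hX' hcov] at this
  exact (ae_map_iff mX' ms).1 this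

end

/-! ### Time translation, the drift term, and the Osgood comparison. -/

section

/-- Lebesgue measure on the time axis `[0, ∞)`. -/
abbrev timeMeasure : Measure ℝ≥0 := Measure.comap (fun t : ℝ≥0 => (t : ℝ)) volume

lemma measurableEmbedding_coe_nnreal : MeasurableEmbedding (fun t : ℝ≥0 => (t : ℝ)) :=
  MeasurableEmbedding.subtype_coe measurableSet_Ici

lemma map_coe_timeMeasure :
    timeMeasure.map (fun t : ℝ≥0 => (t : ℝ)) = volume.restrict (Ici 0) := by
  rw [timeMeasure, measurableEmbedding_coe_nnreal.map_comap]
  congr 1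
  exact NNReal.range_coe

lemma timeMeasure_apply (s : Set ℝ≥0) :
    timeMeasure s = volume ((fun t : ℝ≥0 => (t : ℝ)) '' s) :=
  measurableEmbedding_coe_nnreal.comap_apply _ _

instance : SigmaFinite timeMeasure :=
  SigmaFinite.of_map _ measurableEmbedding_coe_nnreal.measurable.aemeasurable
    (by rw [map_coe_timeMeasure]; infer_instance)

lemma integral_timeMeasure (F : ℝ → ℝ) :
    ∫ s : ℝ≥0, F s ∂timeMeasure = ∫ s in Ici (0 : ℝ), F s := by
  rw [← map_coe_timeMeasure, measurableEmbedding_coe_nnreal.integral_map]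

lemma integrable_timeMeasure_iff (F : ℝ → ℝ) :
    Integrable (fun s : ℝ≥0 => F s) timeMeasure ↔ IntegrableOn F (Ici 0) := by
  rw [IntegrableOn, ← map_coe_timeMeasure, measurableEmbedding_coe_nnreal.integrable_map_iff]
  rfl

lemma timeMeasure_singleton_zero : timeMeasure {0} = 0 := by
  rw [timeMeasure_apply]; simp

lemma map_add_timeMeasure (a : ℝ≥0) :
    timeMeasure.map (fun r => r + a) = timeMeasure.restrict (Ici a) := by
  ext s hs
  rw [Measure.map_apply (by fun_prop) hs, Measure.restrict_apply hs, timeMeasure_apply,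
    timeMeasure_apply,
    ← measure_preimage_add_right volume (a : ℝ) ((fun t : ℝ≥0 => (t : ℝ)) '' (s ∩ Ici a))]
  congr 1
  ext r
  simp only [mem_image, mem_preimage, mem_inter_iff, mem_Ici]
  constructor
  · rintro ⟨r, hr, rfl⟩
    exact ⟨r + a, ⟨hr, le_add_self⟩, by simp⟩
  · rintro ⟨w, ⟨hw, haw⟩, h⟩
    refine ⟨w - a, by rwa [tsub_add_cancel_of_le haw], ?_⟩
    rw [NNReal.coe_sub haw, h]; ring

lemma map_shift_leb (a : ℝ≥0) :
    leb.map (fun z => (z.1 + a, z.2)) = leb.restrict (Ici a ×ˢ univ) := by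
  have : leb = timeMeasure.prod (volume : Measure unitInterval) := rfl
  rw [this, ← Measure.prod_restrict, ← map_add_timeMeasure, Measure.restrict_univ]
  have := Measure.map_prod_map timeMeasure (volume : Measure unitInterval)
    (f := fun r : ℝ≥0 => r + a) (g := id) (by fun_prop) measurable_id
  rw [Measure.map_id] at this
  rw [this]
  rfl

lemma shiftedKernel_add (a t : ℝ≥0) (x : unitInterval) (z : SpaceTime) :
    shiftedKernel (t + a) x (z.1 + a, z.2) = shiftedKernel t x z := by
  unfold shiftedKernel
  by_cases hz : z.1 < t
  · rw [indicator_of_mem (by simpa using hz), indicator_of_mem (by simpa using hz)]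
    simp
  · rw [indicator_of_notMem (by simpa using hz), indicator_of_notMem (by simpa using hz)]

lemma shiftedKernel_nonneg (t : ℝ≥0) (x : unitInterval) (z : SpaceTime) :
    0 ≤ shiftedKernel t x z := by
  unfold shiftedKernel
  refine indicator_nonneg (fun z hz => ?_) z
  have h : z.1 < t := by simpa using hz
  exact dirichletHeatKernel_nonneg (sub_pos.2 (by exact_mod_cast h)) x.2 z.2.2

/-- The contribution of a nonnegative forcing is at most the time integral of its spatial
bound. -/
lemma integral_shiftedKernel_mul_le {t : ℝ≥0} {x : unitInterval} {f : SpaceTime → ℝ} {φ : ℝ → ℝ}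
    (hint : Integrable (fun z => shiftedKernel t x z * f z) leb) (hf : ∀ z, 0 ≤ f z)
    (hfφ : ∀ s y, 0 < s → s < t → f (s, y) ≤ φ s)
    (hφi : IntervalIntegrable φ volume 0 t) :
    ∫ z, shiftedKernel t x z * f z ∂leb ≤ ∫ s in (0 : ℝ)..t, φ s := by
  have hle : leb = timeMeasure.prod (volume : Measure unitInterval) := rfl
  rw [hle] at hint ⊢
  rw [integral_prod _ hint]
  have hφ' : IntegrableOn φ (Ioc 0 (t : ℝ)) :=
    (intervalIntegrable_iff_integrableOn_Ioc_of_le t.2).1 hφi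
  have hi : IntegrableOn φ (Ioo 0 (t : ℝ)) := hφ'.mono_set Ioo_subset_Ioc_self
  calc ∫ s, (∫ y, shiftedKernel t x (s, y) * f (s, y)) ∂timeMeasure
      ≤ ∫ s : ℝ≥0, (Ioo 0 (t : ℝ)).indicator φ s ∂timeMeasure := by
        refine integral_mono_of_nonneg (Eventually.of_forall fun s => integral_nonneg fun y =>
          mul_nonneg (shiftedKernel_nonneg _ _ _) (hf _)) ?_ ?_
        · exact (integrable_timeMeasure_iff _).2
            ((integrable_indicator_iff measurableSet_Ioo).2 hi).integrableOn
        -- The bound by `φ` is assumed only at positive times; time `0` is a null set.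
        · have h0 : ∀ᵐ s ∂timeMeasure, s ≠ 0 := by
            rw [ae_iff]; simp [timeMeasure_singleton_zero]
          filter_upwards [h0] with s hs
          have hs0 : 0 < s := pos_iff_ne_zero.2 hs
          by_cases hst : s < t
          · have hst' : (s : ℝ) < t := by exact_mod_cast hst
            rw [indicator_of_mem (show (s : ℝ) ∈ Ioo 0 (t : ℝ) from
              ⟨by exact_mod_cast hs0, hst'⟩)]
            have hk (y : unitInterval) : shiftedKernel t x (s, y) =
                dirichletHeatKernel ((t : ℝ) - s) x y :=
              indicator_of_mem (by simpa using hst) _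
            have hts : 0 < (t : ℝ) - s := sub_pos.2 hst'
            -- Since the kernel mass is only at most one, replacing it by `1` requires `φ s ≥ 0`.
            have hφ0 : 0 ≤ φ s := (hf (s, 0)).trans (hfφ s 0 hs0 hst)
            have hc : Continuous fun y : unitInterval => dirichletHeatKernel ((t : ℝ) - s) x y :=
              (continuous_dirichletHeatKernel hts x).comp continuous_subtype_val
            calc ∫ y, shiftedKernel t x (s, y) * f (s, y)
                ≤ ∫ y : unitInterval, dirichletHeatKernel ((t : ℝ) - s) x y * φ s := by
                  refine integral_mono_of_nonneg (Eventually.of_forall fun y =>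
                    mul_nonneg (shiftedKernel_nonneg _ _ _) (hf _)) ?_
                    (Eventually.of_forall fun y => ?_)
                  · exact (hc.integrable_of_hasCompactSupport
                      (HasCompactSupport.of_compactSpace _)).mul_const _
                  · simp only [← hk]
                    exact mul_le_mul_of_nonneg_left (hfφ s y hs0 hst) (shiftedKernel_nonneg _ _ _)
              _ = (∫ y : unitInterval, dirichletHeatKernel ((t : ℝ) - s) x y) * φ s :=
                  integral_mul_const _ _
              _ ≤ 1 * φ s := mul_le_mul_of_nonneg_right (integral_dirichletHeatKernel_le_one hts) hφ0
              _ = φ s := one_mul _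
          · rw [indicator_of_notMem (fun h => hst (by exact_mod_cast h.2))]
            have hk (y : unitInterval) : shiftedKernel t x (s, y) = 0 :=
              indicator_of_notMem (by simpa using hst) _
            simp [hk]
    _ = ∫ s in Ioo 0 (t : ℝ), φ s := by
        rw [integral_timeMeasure, setIntegral_indicator measurableSet_Ioo]
        congr 2
        exact inter_eq_right.2 fun s hs => hs.1.le
    _ = ∫ s in (0 : ℝ)..t, φ s := by
        rw [intervalIntegral.integral_of_le t.coe_nonneg, integral_Ioc_eq_integral_Ioo]

lemma integral_dirichletHeatKernel_mul_mem_Icc {t : ℝ} (ht : 0 < t) (x : unitInterval)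
    {f : unitInterval → ℝ} (hf : ∀ y, 0 ≤ f y) {M : ℝ} (hM : ∀ y, f y ≤ M) :
    ∫ y : unitInterval, dirichletHeatKernel t x y * f y ∈ Icc 0 M := by
  have hc : Continuous fun y : unitInterval => dirichletHeatKernel t x y :=
    (continuous_dirichletHeatKernel ht x).comp continuous_subtype_val
  have hk (y : unitInterval) := dirichletHeatKernel_nonneg ht x.2 y.2
  have hM0 : 0 ≤ M := (hf 0).trans (hM 0)
  refine ⟨integral_nonneg fun y => mul_nonneg (hk y) (hf y), ?_⟩
  calc ∫ y : unitInterval, dirichletHeatKernel t x y * f y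
      ≤ ∫ y : unitInterval, dirichletHeatKernel t x y * M := by
        refine integral_mono_of_nonneg (Eventually.of_forall fun y => mul_nonneg (hk y) (hf y))
          ((hc.integrable_of_hasCompactSupport (HasCompactSupport.of_compactSpace _)).mul_const _)
          (Eventually.of_forall fun y => mul_le_mul_of_nonneg_left (hM y) (hk y))
    _ = (∫ y : unitInterval, dirichletHeatKernel t x y) * M := integral_mul_const _ _
    _ ≤ 1 * M := mul_le_mul_of_nonneg_right (integral_dirichletHeatKernel_le_one ht) hM0
    _ = M := one_mul _

/-- If the stochastic convolution is almost surely bounded on a countable set of space-time points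
translated by one unit of time, it is almost surely bounded on the set itself. -/
lemma IsWhiteNoise.ae_bounded_of_ae_bounded_shift {Ω : Type*} {mΩ : MeasurableSpace Ω}
    {P : Measure Ω} {ℱ : Filtration ℝ≥0 mΩ} {W : Set SpaceTime → Ω → ℝ}
    (hW : IsWhiteNoise P ℱ W) {ι : Type*} [Countable ι] (t : ι → ℝ≥0) (x : ι → unitInterval)
    {X V : ι → Ω → ℝ} (hX : ∀ i, HasWienerIntegral P W (shiftedKernel (t i) (x i)) (X i))
    (hV : ∀ i, HasWienerIntegral P W (shiftedKernel (t i + 1) (x i)) (V i))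
    (hb : ∀ᵐ ω ∂P, ∃ K : ℕ, ∀ i, |V i ω| ≤ K) : ∀ᵐ ω ∂P, ∃ K : ℕ, ∀ i, |X i ω| ≤ K := by
  set S : Set SpaceTime := Ici 1 ×ˢ univ with hSdef
  have hS : MeasurableSet S := measurableSet_Ici.prod MeasurableSet.univ
  set h : ι → SpaceTime → ℝ := fun i => shiftedKernel (t i + 1) (x i)
  set hZ : ι → SpaceTime → ℝ := fun i => S.indicator (h i)
  -- `hR i` is `h i` with its sign reversed on `S`. Every linear combination keeps its square on and
  -- off `S`, so the covariances are unchanged.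
  set hR : ι → SpaceTime → ℝ := fun i => h i - (2 : ℝ) • hZ i
  have mZ i : MemLp (hZ i) 2 leb := (hV i).1.indicator hS
  have mR i : MemLp (hR i) 2 leb := (hV i).1.sub ((mZ i).const_smul 2)
  choose Z hZW using fun i => hW.exists_wienerIntegral (mZ i)
  choose R hRW using fun i => hW.exists_wienerIntegral (mR i)
  have bR : ∀ᵐ ω ∂P, ∃ K : ℕ, ∀ i, |R i ω| ≤ K := by
    refine hW.ae_bounded_of_cov_eq hV hRW (fun s c => ?_) hb
    refine integral_congr_ae (Eventually.of_forall fun z => ?_)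
    by_cases hz : z ∈ S
    · have e (i : ι) : hR i z = -h i z := by simp [hR, hZ, hz]; ring
      simp only [e, mul_neg, Finset.sum_neg_distrib, neg_sq]
      rfl
    · have e (i : ι) : hR i z = h i z := by simp [hR, hZ, hz]
      simp only [e]
      rfl
  have bZ : ∀ᵐ ω ∂P, ∃ K : ℕ, ∀ i, |Z i ω| ≤ K := by
    -- The two families differ by twice the part of the noise after time `1`, so that part is
    -- bounded as well.
    have hrel (i : ι) : ∀ᵐ ω ∂P, V i ω - R i ω - 2 * Z i ω = 0 := by
      have := hW.sum_ae_eq_zero (ι := Fin 3) Finset.univ ![1, -1, -2] (h := ![h i, hR i, hZ i])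
        (X := ![V i, R i, Z i]) (fun j => by
          fin_cases j
          · exact hV i
          · exact hRW i
          · exact hZW i) (fun z => by
          simp [Fin.sum_univ_three, hR])
      filter_upwards [this] with ω hω
      simp [Fin.sum_univ_three] at hω
      linarith
    filter_upwards [hb, bR, ae_all_iff.2 hrel] with ω ⟨K, hK⟩ ⟨L, hL⟩ hω
    refine ⟨K + L, fun i => ?_⟩
    have h1 := abs_le.1 (hK i)
    have h2 := abs_le.1 (hL i)
    have h3 := hω i
    push_cast
    exact abs_le.2 ⟨by linarith, by linarith⟩
  -- Translating time by `1` carries the kernels defining `X` to the restrictions to `S` defining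
  -- `Z`, preserving covariances.
  refine hW.ae_bounded_of_cov_eq hZW hX (fun s c => ?_) bZ
  have e1 : (fun z => (∑ i ∈ s, c i * hZ i z) ^ 2) =
      S.indicator fun z => (∑ i ∈ s, c i * h i z) ^ 2 := by
    funext z
    by_cases hz : z ∈ S
    · simp [hZ, hz]
    · simp [hZ, hz]
  have hemb : MeasurableEmbedding fun z : SpaceTime => (z.1 + 1, z.2) := by
    have h1 : Continuous fun z : SpaceTime => (z.1 + 1, z.2) := by fun_prop
    refine h1.measurableEmbedding fun z w hzw => ?_
    simp only [Prod.mk.injEq, add_left_inj] at hzw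
    exact Prod.ext hzw.1 hzw.2
  rw [e1, integral_indicator hS, hSdef, ← map_shift_leb, hemb.integral_map]
  simp only [h, shiftedKernel_add]

/-- Comparison with an autonomous differential inequality, in integral form. -/
lemma osgood_comparison {B φ : ℝ → ℝ} {A K T : ℝ} (hBc : Continuous B) (hBpos : ∀ v, 0 < B v)
    (hBm : Monotone B) (hφc : ContinuousOn φ (Ioo 0 T))
    (hφi : IntervalIntegrable (fun s => B (φ s)) volume 0 T)
    (hφ : ∀ t ∈ Ioo 0 T, φ t ≤ A + ∫ s in (0 : ℝ)..t, B (φ s))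
    (hK : T < ∫ v in A..K, (B v)⁻¹) {t : ℝ} (ht : t ∈ Ioo 0 T) :
    A + ∫ s in (0 : ℝ)..t, B (φ s) ≤ K := by
  have hT : 0 < T := ht.1.trans ht.2
  set F : ℝ → ℝ := fun t => A + ∫ s in (0 : ℝ)..t, B (φ s) with hF
  -- `H w` is the time the flow `y' = B(y)` takes to travel from `A` to `w`.
  set H : ℝ → ℝ := fun w => ∫ v in A..w, (B v)⁻¹ with hH
  have hic : Continuous fun v => (B v)⁻¹ := hBc.inv₀ fun v => (hBpos v).ne'
  have hHd (w : ℝ) : HasDerivAt H (B w)⁻¹ w := hic.integral_hasStrictDerivAt A w |>.hasDerivAt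
  have hHm : StrictMono H := strictMono_of_deriv_pos fun w => by
    rw [(hHd w).deriv]; exact inv_pos.2 (hBpos w)
  have hFd {s : ℝ} (hs : s ∈ Ioo 0 T) : HasDerivAt F (B (φ s)) s := by
    have hc : ContinuousOn (fun s => B (φ s)) (Ioo 0 T) := hBc.comp_continuousOn hφc
    refine HasDerivAt.const_add A (intervalIntegral.integral_hasDerivAt_right
      (hφi.mono_set ?_) ?_ ((hc s hs).continuousAt (Ioo_mem_nhds hs.1 hs.2)))
    · rw [uIcc_of_le hs.1.le, uIcc_of_le hT.le]
      exact Icc_subset_Icc_right hs.2.le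
    · exact hc.stronglyMeasurableAtFilter isOpen_Ioo s hs
  have hFc : ContinuousOn F (Icc 0 T) := by
    refine continuousOn_const.add ?_
    have := intervalIntegral.continuousOn_primitive_interval' hφi left_mem_uIcc
    rwa [uIcc_of_le hT.le] at this
  -- The derivative is `B(φ) / B(F) - 1`, nonpositive because `φ ≤ F` and `B` is monotone. Hence `H
  -- (F t) ≤ t < T < H K`.
  have hanti : AntitoneOn (fun s => H (F s) - s) (Icc 0 T) := by
    refine antitoneOn_of_deriv_nonpos (convex_Icc _ _) ?_ ?_ ?_
    · refine ContinuousOn.sub ?_ continuousOn_id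
      exact (continuous_iff_continuousAt.2 fun w => (hHd w).continuousAt).comp_continuousOn hFc
    · rw [interior_Icc]
      intro s hs
      exact (((hHd _).comp s (hFd hs)).sub (hasDerivAt_id s)).differentiableAt.differentiableWithinAt
    · rw [interior_Icc]
      intro s hs
      have hd : HasDerivAt (fun s => H (F s) - s) ((B (F s))⁻¹ * B (φ s) - 1) s :=
        ((hHd _).comp s (hFd hs)).sub (hasDerivAt_id s)
      rw [hd.deriv, sub_nonpos, inv_mul_le_one₀ (hBpos _)]
      exact hBm (hφ s hs)
  have h0 := hanti (left_mem_Icc.2 hT.le) ⟨ht.1.le, ht.2.le⟩ ht.1.le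
  have hF0 : H (F 0) = 0 := by simp [hF, hH]
  simp only [hF0] at h0
  exact (hHm.lt_iff_lt.1 (show H (F t) < H K by linarith [ht.2])).le

/-- If the Osgood condition fails for `b`, it fails for `c + b⁺`. -/
lemma exists_lt_integral_inv {b : ℝ → ℝ} (hb0 : ∀ v, 0 ≤ b v) (hbc : Continuous b)
    (hbm : MonotoneOn b (Ioi 0)) (hO : ¬ OsgoodCondition b) {c : ℝ} (hc : 0 < c) (A T : ℝ) :
    ∃ K, T < ∫ v in A..K, (c + b (max v 0))⁻¹ := by
  by_contra! hcon
  have hpos (v : ℝ) : 0 < c + b (max v 0) := by linarith [hb0 (max v 0)]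
  have hic : Continuous fun v => (c + b (max v 0))⁻¹ :=
    Continuous.inv₀ (by fun_prop) fun v => (hpos v).ne'
  have hint : IntegrableOn (fun v => (c + b (max v 0))⁻¹) (Ioi A) := by
    refine integrableOn_Ioi_of_intervalIntegral_norm_bounded (l := atTop) (b := id) T A
      (fun K => (hic.integrableOn_Icc (a := A) (b := K)).mono_set Ioc_subset_Icc_self) tendsto_id
      (Eventually.of_forall fun K => ?_)
    simp_rw [fun v => Real.norm_of_nonneg (inv_pos.2 (hpos v)).le]
    exact hcon K
  have hfin : ∫⁻ v in Ioi A, ENNReal.ofReal (c + b (max v 0))⁻¹ < ∞ := by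
    have := hint.2
    rw [HasFiniteIntegral] at this
    refine lt_of_le_of_lt (lintegral_mono fun v => ?_) this
    rw [← ofReal_norm]
    exact ENNReal.ofReal_le_ofReal (le_abs_self _)
  -- If `b` reaches `c` at `s₀`, then `c + b ≤ 2b` beyond `s₀`, and finiteness gives the Osgood
  -- condition. Otherwise the integrand is at least `1 / (2c)` on a half-line.
  by_cases hex : ∃ s₀ > 0, c ≤ b s₀
  · obtain ⟨s₀, hs₀, hcs⟩ := hex
    refine hO ⟨max s₀ A, lt_max_of_lt_left hs₀, ?_⟩
    calc ∫⁻ s in Ioi (max s₀ A), (ENNReal.ofReal (b s))⁻¹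
        ≤ ∫⁻ s in Ioi (max s₀ A), 2 * ENNReal.ofReal (c + b (max s 0))⁻¹ := by
          refine setLIntegral_mono' measurableSet_Ioi fun s hs => ?_
          have h1 : s₀ < s := (le_max_left _ _).trans_lt hs
          have h2 : b s₀ ≤ b s := hbm hs₀ (hs₀.trans h1) h1.le
          have h3 : 0 < b s := by linarith
          rw [max_eq_left (hs₀.trans h1).le, ← ENNReal.ofReal_inv_of_pos h3,
            ← ENNReal.ofReal_ofNat, ← ENNReal.ofReal_mul (by norm_num)]
          refine ENNReal.ofReal_le_ofReal ?_
          rw [← div_eq_mul_inv, inv_eq_one_div, div_le_div_iff₀ h3 (by linarith)]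
          linarith
      _ = 2 * ∫⁻ s in Ioi (max s₀ A), ENNReal.ofReal (c + b (max s 0))⁻¹ :=
          lintegral_const_mul' _ _ (by norm_num)
      _ ≤ 2 * ∫⁻ s in Ioi A, ENNReal.ofReal (c + b (max s 0))⁻¹ := by
          gcongr
          exact le_max_right _ _
      _ < ∞ := ENNReal.mul_lt_top (by norm_num) hfin
  · push Not at hex
    have : ∫⁻ v in Ioi (max A 0), ENNReal.ofReal (2 * c)⁻¹ ≤
        ∫⁻ v in Ioi (max A 0), ENNReal.ofReal (c + b (max v 0))⁻¹ := by
      refine setLIntegral_mono' measurableSet_Ioi fun v hv => ?_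
      have hv0 : 0 < v := (le_max_right _ _).trans_lt hv
      refine ENNReal.ofReal_le_ofReal (inv_anti₀ (hpos v) ?_)
      rw [max_eq_left hv0.le]
      linarith [hex v hv0]
    have h2 := (this.trans (lintegral_mono_set (Ioi_subset_Ioi (le_max_left A 0)))).trans_lt hfin
    rw [setLIntegral_const, Real.volume_Ioi, ENNReal.mul_top
      (by simpa using hc)] at h2
    exact lt_irrefl _ h2

end

/-! ### Bounds uniform in the truncation, and absence of blow-up. -/

section

lemma truncateDrift_nonneg {b : ℝ → ℝ} (hb : ∀ x, 0 ≤ b x) (N : ℕ) (x : ℝ) :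
    0 ≤ truncateDrift b N x := by
  unfold truncateDrift
  split_ifs <;> exact hb _

lemma exists_truncateDrift_le {b : ℝ → ℝ} (hb : Continuous b) (N : ℕ) :
    ∃ C, ∀ x, truncateDrift b N x ≤ C := by
  obtain ⟨C, hC⟩ := (isCompact_Icc (a := -(N : ℝ)) (b := N)).bddAbove_image hb.continuousOn
  have h (x : ℝ) (hx : x ∈ Icc (-(N : ℝ)) N) : b x ≤ C := hC (mem_image_of_mem b hx)
  have hN : (0 : ℝ) ≤ N := by positivity
  refine ⟨C, fun x => ?_⟩
  unfold truncateDrift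
  split_ifs with h1 h2
  · exact h x (abs_le.1 h1)
  · exact h _ ⟨by linarith, le_rfl⟩
  · exact h _ ⟨le_rfl, by linarith⟩

/-- The majorant is free of `N`, which makes the final bound uniform. Above `N` truncation only
lowers `b`, by monotonicity; if `-A ≤ x < -N`, the frozen value is taken at `-N ∈ [-A, 0]`. -/
lemma truncateDrift_le {b : ℝ → ℝ} (hb0 : ∀ x, 0 ≤ b x) (hbm : MonotoneOn b (Ioi 0)) {A C : ℝ}
    (hC : ∀ x ∈ Icc (-A) 0, b x ≤ C) (hC0 : 0 ≤ C) {N : ℕ} (hN : 1 ≤ N) {x : ℝ} (hx : -A ≤ x) :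
    truncateDrift b N x ≤ C + b (max x 0) := by
  have hN' : (0 : ℝ) < N := by exact_mod_cast hN
  have h0 := hb0 (max x 0)
  unfold truncateDrift
  split_ifs with h1 h2
  · rcases le_or_gt x 0 with h | h
    · linarith [hC x ⟨hx, h⟩]
    · rw [max_eq_left h.le]; linarith
  · have h3 : 0 < x := hN'.trans h2
    rw [max_eq_left h3.le]
    linarith [hbm hN' h3 h2.le]
  · have h3 : x < -N := by
      by_contra! h4
      exact h1 (abs_le.2 ⟨h4, not_lt.1 h2⟩)
    linarith [hC (-N) ⟨by linarith, by linarith⟩]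

lemma monotone_comp_max_zero {b : ℝ → ℝ} (hb : Continuous b) (hbm : MonotoneOn b (Ioi 0)) :
    Monotone fun v : ℝ => b (max v 0) := by
  intro v w hvw
  rcases le_or_gt v 0 with hv | hv
  · rcases le_or_gt w 0 with hw | hw
    · simp only [max_eq_right hv, max_eq_right hw, le_refl]
    · simp only [max_eq_right hv, max_eq_left hw.le]
      refine le_of_tendsto ((hb.tendsto 0).mono_left (nhdsWithin_le_nhds (s := Ioi 0))) ?_
      filter_upwards [Ioo_mem_nhdsGT hw] with x hx using hbm hx.1 hw hx.2.le
  · simp only [max_eq_left hv.le, max_eq_left (hv.le.trans hvw)]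
    exact hbm hv (hv.trans_le hvw) hvw

lemma continuousOn_iSup_time {v : ℝ≥0 → unitInterval → ℝ}
    (hv : ContinuousOn (fun z : SpaceTime => v z.1 z.2) (Ioi 0 ×ˢ univ)) :
    ContinuousOn (fun s : ℝ => sSup (v s.toNNReal '' univ)) (Ioi 0) := by
  rw [continuousOn_iff_continuous_domRestrict]
  refine IsCompact.continuous_sSup (f := fun (s : Ioi (0 : ℝ)) x => v (s : ℝ).toNNReal x)
    isCompact_univ ?_
  refine hv.comp_continuous (f := fun p : Ioi (0 : ℝ) × unitInterval =>
    (((p.1 : ℝ).toNNReal, p.2) : SpaceTime)) (by fun_prop) fun p => ?_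
  exact ⟨Real.toNNReal_pos.2 p.1.2, mem_univ _⟩

/-- The mild equation holds almost surely at countably many points at once; path continuity carries
the resulting inequalities to all points. -/
lemma le_of_dense_of_le {D : Set SpaceTime} (hD : Dense D) {T : ℝ≥0} {f g : SpaceTime → ℝ}
    (hf : ContinuousOn f (Ioo 0 T ×ˢ univ)) (hg : ContinuousOn g (Ioo 0 T ×ˢ univ))
    (h : ∀ z ∈ D, z.1 ∈ Ioo 0 T → f z ≤ g z) {z : SpaceTime} (hz : z.1 ∈ Ioo 0 T) :
    f z ≤ g z := by
  have hU : IsOpen (Ioo 0 T ×ˢ univ : Set SpaceTime) := isOpen_Ioo.prod isOpen_univ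
  have hzU : z ∈ (Ioo 0 T ×ˢ univ : Set SpaceTime) := ⟨hz, mem_univ _⟩
  have hcl := hD.open_subset_closure_inter hU hzU
  have hsub : (Ioo 0 T ×ˢ univ : Set SpaceTime) ∩ D ⊆ Ioo 0 T ×ˢ univ := inter_subset_left
  exact ContinuousWithinAt.closure_le hcl ((hf z hzU).mono hsub) ((hg z hzU).mono hsub)
    fun w hw => h w hw.2 hw.1.1

/-- A priori bound on a path of the mild equation, on a time interval on which the sum of the
initial and noise terms is at most `A` in absolute value. -/
lemma path_mem_Icc {v : ℝ≥0 → unitInterval → ℝ} {g B : ℝ → ℝ} {A C K : ℝ} {T : ℝ≥0}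
    {D : Set SpaceTime} (hD : Dense D)
    (hv : ContinuousOn (fun z : SpaceTime => v z.1 z.2) (Ioi 0 ×ˢ univ))
    (hg0 : ∀ w, 0 ≤ g w) (hgC : ∀ w, g w ≤ C) (hgB : ∀ w, -A ≤ w → g w ≤ B w)
    (hBc : Continuous B) (hBpos : ∀ w, 0 < B w) (hBm : Monotone B)
    (hK : (T : ℝ) < ∫ w in A..K, (B w)⁻¹)
    (hmild : ∀ z ∈ D, z.1 ∈ Ioo 0 T →
      Integrable (fun z' : SpaceTime => shiftedKernel z.1 z.2 z' * g (v z'.1 z'.2)) leb ∧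
      |v z.1 z.2 - ∫ z' : SpaceTime, shiftedKernel z.1 z.2 z' * g (v z'.1 z'.2) ∂leb| ≤ A)
    {t : ℝ≥0} (ht : t ∈ Ioo 0 T) (x : unitInterval) : v t x ∈ Icc (-A) K := by
  have hvT : ContinuousOn (fun z : SpaceTime => v z.1 z.2) (Ioo 0 T ×ˢ univ) :=
    hv.mono (prod_mono Ioo_subset_Ioi_self Subset.rfl)
  have lower {t : ℝ≥0} (ht : t ∈ Ioo 0 T) (x : unitInterval) : -A ≤ v t x := by
    refine le_of_dense_of_le hD (f := fun _ => -A) (z := (t, x)) continuousOn_const hvT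
      (fun z hz hzT => ?_) ht
    have h1 := (abs_le.1 (hmild z hz hzT).2).1
    have h2 : 0 ≤ ∫ z' : SpaceTime, shiftedKernel z.1 z.2 z' * g (v z'.1 z'.2) ∂leb :=
      integral_nonneg fun z' => mul_nonneg (shiftedKernel_nonneg _ _ _) (hg0 _)
    linarith
  -- Used twice: with the constant `C` for a crude bound, then with `B ∘ φ`.
  have upper {φ : ℝ → ℝ} (hφ : IntervalIntegrable φ volume 0 T)
      (hgφ : ∀ s y, s ∈ Ioo 0 T → g (v s y) ≤ φ s) {t : ℝ≥0} (ht : t ∈ Ioo 0 T)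
      (x : unitInterval) : v t x ≤ A + ∫ s in (0 : ℝ)..t, φ s := by
    refine le_of_dense_of_le hD (g := fun z : SpaceTime => A + ∫ s in (0 : ℝ)..z.1, φ s)
      (z := (t, x)) hvT ?_ (fun z hz hzT => ?_) ht
    · refine continuousOn_const.add ?_
      have := intervalIntegral.continuousOn_primitive_interval' hφ left_mem_uIcc
      refine this.comp (f := fun z : SpaceTime => (z.1 : ℝ)) (by fun_prop) fun z hz => ?_
      rw [uIcc_of_le T.coe_nonneg]
      exact ⟨z.1.coe_nonneg, by exact_mod_cast hz.1.2.le⟩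
    · obtain ⟨h1, h2⟩ := hmild z hz hzT
      have h3 := integral_shiftedKernel_mul_le (f := fun z' : SpaceTime => g (v z'.1 z'.2)) h1
        (fun z' => hg0 _) (fun s y hs hst => hgφ s y ⟨hs, hst.trans hzT.2⟩) (φ := φ)
        (hφ.mono_set (by
          rw [uIcc_of_le T.coe_nonneg, uIcc_of_le z.1.coe_nonneg]
          exact Icc_subset_Icc_right (by exact_mod_cast hzT.2.le)))
      have h4 := (abs_le.1 h2).2
      linarith
  refine ⟨lower ht x, ?_⟩
  have hC0 : 0 ≤ C := (hg0 0).trans (hgC 0)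
  -- `C` may depend on the truncation level. This bound only ensures that the supremum `φ` is finite
  -- and `B ∘ φ` integrable; it does not enter `K`.
  have crude {t : ℝ≥0} (ht : t ∈ Ioo 0 T) (x : unitInterval) : v t x ≤ A + T * C := by
    have := upper (φ := fun _ => C) (by simp) (fun s y _ => hgC _) ht x
    simp only [intervalIntegral.integral_const, sub_zero, smul_eq_mul] at this
    have h2 : (t : ℝ) * C ≤ T * C := mul_le_mul_of_nonneg_right (by exact_mod_cast ht.2.le) hC0
    linarith
  set φ : ℝ → ℝ := fun s => sSup (v s.toNNReal '' univ) with hφdef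
  have hTmem {s : ℝ} (hs : s ∈ Ioo 0 (T : ℝ)) : s.toNNReal ∈ Ioo 0 T :=
    ⟨Real.toNNReal_pos.2 hs.1, by rw [Real.toNNReal_lt_iff_lt_coe hs.1.le]; exact hs.2⟩
  have hφc : ContinuousOn φ (Ioo 0 (T : ℝ)) :=
    (continuousOn_iSup_time hv).mono Ioo_subset_Ioi_self
  have hbdd {s : ℝ≥0} (hs : s ∈ Ioo 0 T) : BddAbove (v s '' univ) :=
    ⟨A + T * C, by rintro _ ⟨y, -, rfl⟩; exact crude hs y⟩
  have hvφ {s : ℝ≥0} (hs : s ∈ Ioo 0 T) (y : unitInterval) : v s y ≤ φ s := by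
    simp only [hφdef, Real.toNNReal_coe]
    exact le_csSup (hbdd hs) ⟨y, mem_univ _, rfl⟩
  have hφle {s : ℝ} {M : ℝ} (hM : ∀ y, v s.toNNReal y ≤ M) : φ s ≤ M :=
    csSup_le ⟨_, 0, mem_univ _, rfl⟩ (by rintro _ ⟨y, -, rfl⟩; exact hM y)
  have hφi : IntervalIntegrable (fun s => B (φ s)) volume 0 T := by
    rw [intervalIntegrable_iff_integrableOn_Ioo_of_le T.coe_nonneg]
    refine Integrable.of_bound
      ((hBc.comp_continuousOn hφc).aestronglyMeasurable measurableSet_Ioo) (B (A + T * C)) ?_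
    filter_upwards [ae_restrict_mem measurableSet_Ioo] with s hs
    rw [Real.norm_of_nonneg (hBpos _).le]
    exact hBm (hφle (crude (hTmem hs)))
  have hmain {t : ℝ≥0} (ht : t ∈ Ioo 0 T) (x : unitInterval) :
      v t x ≤ A + ∫ s in (0 : ℝ)..t, B (φ s) :=
    upper hφi (fun s y hs => (hgB _ (lower hs y)).trans (hBm (hvφ hs y))) ht x
  refine (hmain ht x).trans (osgood_comparison hBc hBpos hBm hφc hφi (fun s hs => ?_) hK
    ⟨by exact_mod_cast ht.1, by exact_mod_cast ht.2⟩)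
  refine hφle fun y => ?_
  have := hmain (hTmem hs) y
  rwa [Real.coe_toNNReal _ hs.1.le] at this

variable {Ω : Type*} {mΩ : MeasurableSpace Ω} {P : Measure Ω} {ℱ : Filtration ℝ≥0 mΩ}
  {W : Set SpaceTime → Ω → ℝ}

lemma le_exitTime {v : ℝ≥0 → unitInterval → Ω → ℝ} {N : ℕ} {ω : Ω} {T : ℝ≥0}
    (h : ∀ t ∈ Ioo 0 T, ∀ x, |v t x ω| ≤ N) : (T : ℝ≥0∞) ≤ exitTime v N ω := by
  refine le_iInf₂ fun t ht => ?_
  by_contra! hlt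
  refine ht.2.not_ge (iSup_le fun x => ?_)
  have := h t ⟨ht.1, by exact_mod_cast hlt⟩ x
  rw [← ofReal_norm, Real.norm_eq_abs, ← ENNReal.ofReal_natCast]
  exact ENNReal.ofReal_le_ofReal this

/-- The stochastic convolution is almost surely bounded on countable subsets of bounded time
intervals `(0, T)`. -/
lemma IsGlobalSolution.ae_bounded_noise (hW : IsWhiteNoise P ℱ W) {σ : ℝ} (hσ : 0 < σ)
    {g : ℝ → ℝ} (hg0 : ∀ w, 0 ≤ g w) {C : ℝ} (hgC : ∀ w, g w ≤ C) {u₀ : unitInterval → ℝ}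
    (hu₀ : ∀ y, 0 ≤ u₀ y) {M : ℝ} (hM : ∀ y, u₀ y ≤ M) {u : ℝ≥0 → unitInterval → Ω → ℝ}
    (hu : IsGlobalSolution P ℱ W g σ u₀ u) {X : ℝ≥0 → unitInterval → Ω → ℝ}
    (hX : ∀ t x, 0 < t → HasWienerIntegral P W (shiftedKernel t x) (X t x))
    {D : Set SpaceTime} (hD : D.Countable) (T : ℝ≥0) :
    ∀ᵐ ω ∂P, ∃ K : ℕ, ∀ z ∈ D, z.1 ∈ Ioo 0 T → |X z.1 z.2 ω| ≤ K := by
  set ι := {z : SpaceTime // z ∈ D ∧ z.1 ∈ Ioo 0 T}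
  have : Countable ι := (hD.mono (sep_subset D fun z => z.1 ∈ Ioo 0 T)).to_subtype
  have hC0 : 0 ≤ C := (hg0 0).trans (hgC 0)
  suffices h : ∀ᵐ ω ∂P, ∃ K : ℕ, ∀ i : ι, |X i.1.1 i.1.2 ω| ≤ K by
    filter_upwards [h] with ω ⟨K, hK⟩
    exact ⟨K, fun z hz hzT => hK ⟨z, hz, hzT⟩⟩
  refine hW.ae_bounded_of_ae_bounded_shift (fun i : ι => i.1.1) (fun i => i.1.2)
    (V := fun i => X (i.1.1 + 1) i.1.2) (fun i => hX _ _ i.2.2.1) (fun i => hX _ _ (by simp)) ?_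
  have hmild (i : ι) : ∀ᵐ ω ∂P, ∃ a ∈ Icc 0 M, ∃ d ∈ Icc 0 ((T + 1) * C),
      u (i.1.1 + 1) i.1.2 ω = a + d + σ * X (i.1.1 + 1) i.1.2 ω := by
    have hpos : 0 < i.1.1 + 1 := by simp
    obtain ⟨Y, hY, hYeq⟩ := hu.mild (i.1.1 + 1) i.1.2 hpos
    filter_upwards [hYeq, hW.wienerIntegral_unique hY (hX _ _ hpos)] with ω hω hYX
    refine ⟨_, integral_dirichletHeatKernel_mul_mem_Icc (by exact_mod_cast hpos) i.1.2 hu₀ hM, _,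
      ⟨integral_nonneg fun z => mul_nonneg (shiftedKernel_nonneg _ _ _) (hg0 _), ?_⟩,
      by rw [← hYX]; exact hω.2⟩
    have := integral_shiftedKernel_mul_le (f := fun z : SpaceTime => g (u z.1 z.2 ω))
      (φ := fun _ => C) hω.1 (fun z => hg0 _) (fun s y _ _ => hgC _) (by simp)
    refine this.trans ?_
    simp only [intervalIntegral.integral_const, sub_zero, smul_eq_mul, NNReal.coe_add,
      NNReal.coe_one]
    have hiT : (i.1.1 : ℝ) ≤ T := by exact_mod_cast i.2.2.2.le
    exact mul_le_mul_of_nonneg_right (by linarith) hC0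
  filter_upwards [ae_all_iff.2 hmild, hu.continuous] with ω hω hcont
  -- After the shift, times lie in `[1, T + 1]`, a compact interval away from `0`, where the path is
  -- continuous.
  have hcpt : IsCompact (Icc 1 (T + 1) ×ˢ univ : Set SpaceTime) := isCompact_Icc.prod isCompact_univ
  obtain ⟨L, hL⟩ := hcpt.exists_bound_of_continuousOn (hcont.mono (prod_mono
    (fun s hs => lt_of_lt_of_le zero_lt_one hs.1) Subset.rfl))
  -- Solving the mild equation for the noise gives `σ |X| ≤ L + M + (T + 1) C`.
  obtain ⟨K, hK⟩ := exists_nat_ge ((L + M + (T + 1) * C) / σ)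
  refine ⟨K, fun i => ?_⟩
  obtain ⟨a, ha, d, hd, hi⟩ := hω i
  have hLi := hL (i.1.1 + 1, i.1.2) ⟨⟨by simp, by simpa using i.2.2.2.le⟩, mem_univ _⟩
  rw [Real.norm_eq_abs, abs_le] at hLi
  refine le_trans ?_ hK
  rw [le_div_iff₀' hσ]
  nth_rw 1 [← abs_of_pos hσ]
  rw [← abs_mul, abs_le]
  have := ha.1; have := ha.2; have := hd.1; have := hd.2; have := hLi.1; have := hLi.2
  simp only at *
  exact ⟨by linarith, by linarith⟩

/-- If the Osgood condition fails, the solution does not blow up before any given time. -/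
lemma ae_le_blowupTime (hW : IsWhiteNoise P ℱ W) {σ : ℝ} (hσ : 0 < σ) {b : ℝ → ℝ}
    (hb0 : ∀ x, 0 ≤ b x) (hbc : Continuous b) (hbm : MonotoneOn b (Ioi 0))
    {u₀ : unitInterval → ℝ} (hu₀ : ∀ x, 0 ≤ u₀ x) (hu₀c : Continuous u₀)
    {u : ℕ → ℝ≥0 → unitInterval → Ω → ℝ}
    (hu : ∀ N : ℕ, 1 ≤ N → IsGlobalSolution P ℱ W (truncateDrift b N) σ u₀ (u N))
    (hO : ¬ OsgoodCondition b) (T : ℝ≥0) : ∀ᵐ ω ∂P, (T : ℝ≥0∞) ≤ blowupTime u ω := by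
  obtain ⟨M, hM⟩ := isCompact_univ.bddAbove_image hu₀c.continuousOn
  replace hM (y : unitInterval) : u₀ y ≤ M := hM ⟨y, mem_univ _, rfl⟩
  have hM0 : 0 ≤ M := (hu₀ 0).trans (hM 0)
  obtain ⟨D, hDc, hD⟩ := TopologicalSpace.exists_countable_dense SpaceTime
  -- The noise terms come from the equation for `u 1`; uniqueness of Wiener integrals lets them
  -- serve every `N`, so a single bound `A` works for all truncations.
  choose! X hX using (hu 1 le_rfl).mild
  choose! C hC using exists_truncateDrift_le hbc
  have hnoise := (hu 1 le_rfl).ae_bounded_noise hW hσ (truncateDrift_nonneg hb0 1) (hC 1) hu₀ hM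
    (fun t x ht => (hX t x ht).1) hDc T
  have hmild : ∀ᵐ ω ∂P, ∀ N : ℕ, ∀ z ∈ D, 1 ≤ N → 0 < z.1 →
      Integrable (fun z' : SpaceTime =>
        shiftedKernel z.1 z.2 z' * truncateDrift b N (u N z'.1 z'.2 ω)) leb ∧
      u N z.1 z.2 ω = (∫ y : unitInterval, dirichletHeatKernel z.1 z.2 y * u₀ y)
        + (∫ z' : SpaceTime, shiftedKernel z.1 z.2 z' *
          truncateDrift b N (u N z'.1 z'.2 ω) ∂leb) + σ * X z.1 z.2 ω := by
    refine ae_all_iff.2 fun N => (ae_ball_iff hDc).2 fun z _ => ?_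
    by_cases hN : 1 ≤ N
    · by_cases hz : 0 < z.1
      · obtain ⟨Y, hY, hYeq⟩ := (hu N hN).mild z.1 z.2 hz
        filter_upwards [hYeq, hW.wienerIntegral_unique hY (hX _ _ hz).1] with ω hω hYX _ _
        rw [← hYX]
        exact hω
      · exact Eventually.of_forall fun ω _ h => absurd h hz
    · exact Eventually.of_forall fun ω h => absurd h hN
  have hcont : ∀ᵐ ω ∂P, ∀ N : ℕ, 1 ≤ N →
      ContinuousOn (fun z : SpaceTime => u N z.1 z.2 ω) (Ioi 0 ×ˢ univ) := by
    refine ae_all_iff.2 fun N => ?_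
    by_cases hN : 1 ≤ N
    · filter_upwards [(hu N hN).continuous] with ω hω _ using hω
    · exact Eventually.of_forall fun ω h => absurd h hN
  filter_upwards [hnoise, hmild, hcont] with ω ⟨k, hk⟩ hω hcω
  set A : ℝ := M + σ * k with hA
  have hA0 : 0 ≤ A := by positivity
  obtain ⟨c, hc⟩ := (isCompact_Icc (a := -A) (b := 0)).bddAbove_image hbc.continuousOn
  replace hc (x : ℝ) (hx : x ∈ Icc (-A) 0) : b x ≤ c := hc ⟨x, hx, rfl⟩
  have hc0 : 0 ≤ c := (hb0 0).trans (hc 0 ⟨by linarith, le_rfl⟩)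
  -- `c + 1` replaces `c` to make the majorant strictly positive.
  obtain ⟨K, hK⟩ := exists_lt_integral_inv hb0 hbc hbm hO (c := c + 1) (by linarith) A T
  -- `K` was fixed before `N`, so `N` can be taken large enough that `[-A, K] ⊆ [-N, N]`.
  obtain ⟨N, hNK⟩ := exists_nat_ge (max (max K A) 1)
  have hN1 : 1 ≤ N := by exact_mod_cast (le_max_right _ _).trans hNK
  have hNK' : K ≤ N := ((le_max_left _ _).trans (le_max_left _ _)).trans hNK
  have hNA : A ≤ N := ((le_max_right _ _).trans (le_max_left _ _)).trans hNK
  have hbm0 := monotone_comp_max_zero hbc hbm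
  refine le_trans (le_exitTime fun t ht x => ?_) (le_iSup₂ (f := fun N _ => exitTime (u N) N ω) N hN1)
  have := path_mem_Icc (v := fun t x => u N t x ω) (g := truncateDrift b N)
    (B := fun v => c + 1 + b (max v 0)) hD (hcω N hN1) (truncateDrift_nonneg hb0 N) (hC N)
    (fun w hw => (truncateDrift_le hb0 hbm hc hc0 hN1 hw).trans (by linarith))
    (by fun_prop) (fun w => by linarith [hb0 (max w 0)])
    (fun v w hvw => by simpa using hbm0 hvw) hK (fun z hz hzT => ?_) ht x
  · exact abs_le.2 ⟨by linarith [this.1], by linarith [this.2]⟩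
  · obtain ⟨h1, h2⟩ := hω N z hz hN1 hzT.1
    refine ⟨h1, ?_⟩
    have h3 := integral_dirichletHeatKernel_mul_mem_Icc (t := (z.1 : ℝ)) (by exact_mod_cast hzT.1) z.2 hu₀ hM
    have h4 : |σ * X z.1 z.2 ω| ≤ σ * k := by
      rw [abs_mul, abs_of_pos hσ]
      exact mul_le_mul_of_nonneg_left (hk z hz hzT) hσ.le
    rw [abs_le] at h4
    rw [h2, abs_le, hA, add_right_comm, add_sub_cancel_right]
    exact ⟨by linarith [h3.1, h4.1], by linarith [h3.2, h4.2]⟩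

end

end OsgoodSPDE

end

theorem mainTheorem1
    {Ω : Type*} {mΩ : MeasurableSpace Ω} (P : Measure Ω) [IsProbabilityMeasure P]
    (ℱ : Filtration ℝ≥0 mΩ) (W : Set OsgoodSPDE.SpaceTime → Ω → ℝ)
    (hW : OsgoodSPDE.IsWhiteNoise P ℱ W)
    (σ : ℝ) (hσ : 0 < σ)
    (b : ℝ → ℝ) (hb_nonneg : ∀ x, 0 ≤ b x) (hb_lip : LocallyLipschitz b)
    (hb_mono : MonotoneOn b (Set.Ioi 0))
    (u₀ : unitInterval → ℝ) (hu₀_nonneg : ∀ x, 0 ≤ u₀ x) (hu₀_cont : Continuous u₀)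
    (u : ℕ → ℝ≥0 → unitInterval → Ω → ℝ)
    (hu : ∀ N : ℕ, 1 ≤ N →
      OsgoodSPDE.IsGlobalSolution P ℱ W (OsgoodSPDE.truncateDrift b N) σ u₀ (u N))
    (hblowup : 0 < P {ω | OsgoodSPDE.blowupTime u ω < ∞}) :
    OsgoodSPDE.OsgoodCondition b := by
  by_contra hO
  have h : ∀ᵐ ω ∂P, ∀ T : ℕ, ((T : ℝ≥0) : ℝ≥0∞) ≤ OsgoodSPDE.blowupTime u ω :=
    ae_all_iff.2 fun T => OsgoodSPDE.ae_le_blowupTime hW hσ hb_nonneg hb_lip.continuous hb_mono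
      hu₀_nonneg hu₀_cont hu hO T
  refine hblowup.ne' (measure_eq_zero_iff_ae_notMem.2 ?_)
  filter_upwards [h] with ω hω
  simp only [not_lt, top_le_iff]
  refine ENNReal.eq_top_of_forall_nnreal_le fun r => ?_
  obtain ⟨n, hn⟩ := exists_nat_ge r
  exact (by exact_mod_cast hn : (r : ℝ≥0∞) ≤ ((n : ℝ≥0) : ℝ≥0∞)).trans (hω n)
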